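/- Let $k \ge 2$ be an integer with $k \notin \{3, 5, 7, 13\}$, and let $\rho = \rho(k) := \min\{\ell \in \mathbb{Z}^+ : \ell \nmid k-1\}$. Let $\mathcal{A}$ be a finite set, and let $\mathcal{F}$ be the free semigroup on the alphabet $\mathcal{A}$, that is, the set of all finite words (including the empty word) with letters in $\mathcal{A}$, under concatenation. For $\ell \ge 2$, a set $S \subseteq \mathcal{F}$ is called *$\ell$-product-free* if $x_1 x_2 \cdots x_\ell \notin S$ for all (not necessarily distinct) $x_1, \dots, x_\ell \in S$, and *strongly $\ell$-product-free* if it is $j$-product-free for every $j = 2, \dots, \ell$. The *upper Banach density* of $B \subseteq \mathcal{F}$ is $$d^{*}(B) := \limsup_{I \to \infty} \frac{1}{|I|} \sum_{n \in I} \frac{|\{w \in B : |w| = n\}|}{|\mathcal{A}|^{n}},$$ where $|w|$ is the length of $w$, $I$ ranges over finite intervals of positive integers, and $I \to \infty$ means that both $|I|$ and $\min I$ tend to infinity. Suppose that $S \subseteq \mathcal{F}$ is $k$-product-free and $d^{*}(S) = 1/\rho$. Then $S$ is strongly $\rho$-product-free, and it is possible to label each letter of $\mathcal{A}$ with an element of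 $\mathbb{Z}/\rho\mathbb{Z}$ such that $S$ is a subset of $$T := \{w \in \mathcal{F} : \text{the sum of the labels of the letters of } w \text{ (with multiplicity) is } 1 \bmod \rho\},$$ and this set $T$ is $k$-product-free. -/

import Mathlib

open Filter

/-- A subset `S` of a monoid is `k`-product-free if no product `x₁ ⋯ x_k` of `k` (not necessarily
distinct) elements of `S` lies in `S`. -/
def IsProductFree {M : Type*} [Monoid M] (k : ℕ) (S : Set M) : Prop :=
  ∀ x : Fin k → M, (∀ i, x i ∈ S) → (List.ofFn x).prod ∉ S

/-- `S` is strongly `k`-product-free if it is `ℓ`-product-free for every `ℓ = 2, …, k`. -/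
def IsStronglyProductFree {M : Type*} [Monoid M] (k : ℕ) (S : Set M) : Prop :=
  ∀ l : ℕ, 2 ≤ l → l ≤ k → IsProductFree l S

/-- `ρ(k)`, the least positive integer that does not divide `k - 1` (used for `k ≥ 2`). -/
noncomputable def rho (k : ℕ) : ℕ :=
  sInf {l : ℕ | 0 < l ∧ ¬ l ∣ k - 1}

/-- The length `n` layer `B(n)` of a set `B` of words over the alphabet `A`. The free semigroup of
all finite words (including the empty word) under concatenation is `FreeMonoid A`. -/
def layer {A : Type*} (B : Set (FreeMonoid A)) (n : ℕ) : Set (FreeMonoid A) :=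
  {w | w ∈ B ∧ w.length = n}

/-- The density `|B(n)| / |A|ⁿ` of `B` on layer `n`. -/
noncomputable def layerDensity {A : Type*} [Fintype A] (B : Set (FreeMonoid A)) (n : ℕ) : ℝ :=
  ((layer B n).ncard : ℝ) / (Fintype.card A : ℝ) ^ n

/-- The density of `B` on the interval `I = {m, m + 1, …, m + L - 1}` of lengths: the average of the
layer densities over `I`. -/
noncomputable def intervalDensity {A : Type*} [Fintype A] (B : Set (FreeMonoid A)) (m L : ℕ) : ℝ :=
  (∑ n ∈ Finset.Ico m (m + L), layerDensity B n) / (L : ℝ)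

/-- The upper Banach density `d*(B)`: the limit superior of the densities of `B` on intervals `I`
as both `min I` (first coordinate) and `|I|` (second coordinate) tend to infinity. All the densities
lie in `[0, 1]`, so the real limit superior is the true one. -/
noncomputable def upperBanachDensity {A : Type*} [Fintype A] (B : Set (FreeMonoid A)) : ℝ :=
  limsup (fun p : ℕ × ℕ => intervalDensity B p.1 p.2) (atTop ×ˢ atTop)

/-- The set of words whose letter labels (in `ℤ/rℤ`) sum, with multiplicity, to `1` mod `r`. -/
def labelSumOne {A : Type*} {r : ℕ} (label : A → ZMod r) : Set (FreeMonoid A) :=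
  {w | (w.toList.map label).sum = 1}

/-! Write `B/u` for `leftQuotient B u` and `ρ` for `rho k`. Along an ultrafilter that realises
`d*(S)`, the interval densities converge to a finitely additive mean `m` with `m S = 1/ρ`, and `m B`
is the average of the means of `B/a` over the letters `a`. Let `M` be the supremum of the `m (S/u)`.

The engine is `exists_not_isNegligible_pow_mul`. Start at a word whose cone nearly attains `M` and
keep prepending elements of a non-negligible set `P`; outside a negligible set of choices the new
cone again nearly attains `M`. If `S` had few elements in `P^(hc) * S` for every `c ∈ C`, cones of
the chain at distance in `C` would be nearly disjoint, so `M` could not exceed the density of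
integer sets without differences in `C`. With `P = S` and `C = {1, …, n - 1}`, strongly
`n`-product-free sets have `M ≤ 1/n`.

For a `k`-product-free `S` with `M ≥ 1/ρ` and `2 ≤ ℓ ≤ ρ`, the set `S ∩ S^ℓ` is negligible
(`isNegligible_inter_pow`). Otherwise its elements count both as `1` and as `ℓ` factors. Two rounds
of the engine produce elements of `S` that are products of so many different numbers of elements of
`S` that `k` is among them. This uses that `ℓ - 1` divides `k - 1`, and a numerical condition on
`k`.

Removing these products leaves a strongly `ρ`-product-free `R ⊆ S`, and equality in the density
bound forces every `R/u` to have mean exactly `1/ρ`. For `s ∈ R` the sets `R/s^i`, `i < ρ`, then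
partition the words up to a null set, and each letter acts on these classes as a power of `s`; the
exponent is its label (`exists_label`). Finally, an element of `S` with label sum other than `1`
could be combined with elements of `R` into a forbidden product of `k` factors. -/

section

open scoped Pointwise

/-- The words `w` such that `u * w ∈ B`. -/
def leftQuotient {A : Type*} (B : Set (FreeMonoid A)) (u : FreeMonoid A) : Set (FreeMonoid A) :=
  {w | u * w ∈ B}

@[simp] theorem mem_leftQuotient {A : Type*} {B : Set (FreeMonoid A)} {u w : FreeMonoid A} :
    w ∈ leftQuotient B u ↔ u * w ∈ B := Iff.rfl

theorem leftQuotient_one {A : Type*} (B : Set (FreeMonoid A)) : leftQuotient B 1 = B := by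
  ext w; simp

theorem leftQuotient_leftQuotient {A : Type*} (B : Set (FreeMonoid A)) (u v : FreeMonoid A) :
    leftQuotient (leftQuotient B u) v = leftQuotient B (u * v) := by
  ext w; simp [mul_assoc]

theorem finite_layer {A : Type*} [Fintype A] (B : Set (FreeMonoid A)) (n : ℕ) :
    (layer B n).Finite :=
  (List.finite_length_eq A n).subset fun _ hw => hw.2

/-- The average of `f` over all words of length `n`. -/
noncomputable def wordAvg {A : Type*} [Fintype A] : ℕ → (FreeMonoid A → ℝ) → ℝ
  | 0, f => f 1
  | n + 1, f => (∑ a : A, wordAvg n fun w => f (FreeMonoid.of a * w)) / Fintype.card A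

/-! ### Averages over words of fixed length and layer densities -/

section wordAvg

variable {A : Type*} [Fintype A]

theorem wordAvg_mono {n : ℕ} {f g : FreeMonoid A → ℝ} (h : ∀ w, f w ≤ g w) :
    wordAvg n f ≤ wordAvg n g := by
  induction n generalizing f g with
  | zero => exact h 1
  | succ n ih =>
    simp only [wordAvg]
    gcongr
    exact ih fun w => h _

theorem wordAvg_const [Nonempty A] (n : ℕ) (c : ℝ) :
    wordAvg n (fun _ : FreeMonoid A => c) = c := by
  induction n with
  | zero => rfl
  | succ n ih =>
    have : (Fintype.card A : ℝ) ≠ 0 := by exact_mod_cast Fintype.card_ne_zero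
    simp only [wordAvg, ih, Finset.sum_const, Finset.card_univ, nsmul_eq_mul]
    field_simp

theorem wordAvg_nonneg [Nonempty A] {n : ℕ} {f : FreeMonoid A → ℝ} (h : ∀ w, 0 ≤ f w) :
    0 ≤ wordAvg n f := by
  simpa [wordAvg_const] using wordAvg_mono (n := n) h

theorem wordAvg_sub (n : ℕ) (f g : FreeMonoid A → ℝ) :
    wordAvg n (fun w => f w - g w) = wordAvg n f - wordAvg n g := by
  induction n generalizing f g with
  | zero => rfl
  | succ n ih => simp only [wordAvg, ih, Finset.sum_sub_distrib, sub_div]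

theorem wordAvg_const_mul (n : ℕ) (c : ℝ) (f : FreeMonoid A → ℝ) :
    wordAvg n (fun w => c * f w) = c * wordAvg n f := by
  induction n generalizing f with
  | zero => rfl
  | succ n ih => simp only [wordAvg, ih, ← Finset.mul_sum, mul_div_assoc]

theorem wordAvg_add (n k : ℕ) (f : FreeMonoid A → ℝ) :
    wordAvg (n + k) f = wordAvg n fun v => wordAvg k fun w => f (v * w) := by
  induction n generalizing f with
  | zero => simp [wordAvg]
  | succ n ih =>
    rw [Nat.succ_add]
    simp only [wordAvg, ih, mul_assoc]

/-- A single word of length `n` carries a fraction `|A|⁻ⁿ` of the average. -/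
theorem le_wordAvg [Nonempty A] {f : FreeMonoid A → ℝ} (h : ∀ w, 0 ≤ f w) (u : FreeMonoid A) :
    f u / (Fintype.card A : ℝ) ^ u.length ≤ wordAvg u.length f := by
  induction u using FreeMonoid.inductionOn' generalizing f with
  | one => simp [wordAvg]
  | of_mul a u ih =>
    rw [FreeMonoid.length_mul, FreeMonoid.length_of, add_comm, pow_succ, ← div_div, wordAvg]
    gcongr
    refine (ih fun w => h _).trans ?_
    exact Finset.single_le_sum (f := fun a => wordAvg u.length fun w => f (FreeMonoid.of a * w))
      (fun a _ => wordAvg_nonneg fun w => h _) (Finset.mem_univ a)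

theorem layerDensity_nonneg (B : Set (FreeMonoid A)) (n : ℕ) : 0 ≤ layerDensity B n := by
  unfold layerDensity; positivity

theorem ncard_layer_succ (B : Set (FreeMonoid A)) (n : ℕ) :
    (layer B (n + 1)).ncard = ∑ a : A, (layer (leftQuotient B (FreeMonoid.of a)) n).ncard := by
  have (a : A) : Finite (layer (leftQuotient B (FreeMonoid.of a)) n) := finite_layer _ _
  rw [← Nat.card_coe_set_eq]
  simp_rw [← Nat.card_coe_set_eq]
  rw [← Nat.card_sigma]
  symm
  refine Nat.card_eq_of_bijective
    (fun p : (a : A) × layer (leftQuotient B (FreeMonoid.of a)) n =>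
      (⟨FreeMonoid.of p.1 * p.2.1, p.2.2.1, by
        rw [FreeMonoid.length_mul, FreeMonoid.length_of, p.2.2.2, add_comm]⟩ : layer B (n + 1)))
    ⟨?_, ?_⟩
  · rintro ⟨a, w, hw⟩ ⟨b, v, hv⟩ h
    have h' : (a :: FreeMonoid.toList w) = b :: FreeMonoid.toList v := congrArg Subtype.val h
    obtain ⟨rfl, h2⟩ := List.cons.inj h'
    have : w = v := h2
    subst this
    rfl
  · rintro ⟨w, hw, hl⟩
    match w, hw, hl with
    | [], _, hl => exact absurd (show 0 = n + 1 from hl) (by omega)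
    | a :: w, hw, hl =>
      refine ⟨⟨a, w, hw, ?_⟩, rfl⟩
      exact Nat.succ.inj hl

theorem layerDensity_succ (B : Set (FreeMonoid A)) (n : ℕ) :
    layerDensity B (n + 1) =
      (∑ a : A, layerDensity (leftQuotient B (FreeMonoid.of a)) n) / Fintype.card A := by
  simp only [layerDensity, ncard_layer_succ, pow_succ, ← Finset.sum_div, div_div, Nat.cast_sum]

theorem layerDensity_eq_wordAvg (B : Set (FreeMonoid A)) (n : ℕ) :
    layerDensity B n = wordAvg n (B.indicator 1) := by
  induction n generalizing B with
  | zero =>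
    by_cases h : (1 : FreeMonoid A) ∈ B
    · have : layer B 0 = {1} := by
        ext w
        simp only [layer, Set.mem_ofPred_eq, FreeMonoid.length_eq_zero, Set.mem_singleton_iff]
        exact ⟨fun h => h.2, fun e => ⟨e ▸ h, e⟩⟩
      simp [layerDensity, wordAvg, this, h]
    · have : layer B 0 = ∅ := by
        ext w
        simp only [layer, Set.mem_ofPred_eq, FreeMonoid.length_eq_zero, Set.mem_empty_iff_false,
          iff_false]
        rintro ⟨h1, rfl⟩
        exact h h1
      simp [layerDensity, wordAvg, this, h]
  | succ n ih =>
    rw [layerDensity_succ]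
    simp only [wordAvg, ih]
    rfl

theorem layerDensity_univ [Nonempty A] (n : ℕ) :
    layerDensity (Set.univ : Set (FreeMonoid A)) n = 1 := by
  rw [layerDensity_eq_wordAvg, Set.indicator_univ]
  exact wordAvg_const n 1

theorem layerDensity_union {B C : Set (FreeMonoid A)} (h : Disjoint B C) (n : ℕ) :
    layerDensity (B ∪ C) n = layerDensity B n + layerDensity C n := by
  have h1 : layer (B ∪ C) n = layer B n ∪ layer C n := by
    ext w; simp only [layer, Set.mem_union, Set.mem_ofPred_eq]; tauto
  have h2 : Disjoint (layer B n) (layer C n) := h.mono (fun _ h => h.1) (fun _ h => h.1)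
  rw [layerDensity, h1, Set.ncard_union_eq h2 (finite_layer _ _) (finite_layer _ _)]
  simp [layerDensity, add_div]

theorem layerDensity_le_one [Nonempty A] (B : Set (FreeMonoid A)) (n : ℕ) :
    layerDensity B n ≤ 1 := by
  have h := layerDensity_union (disjoint_compl_right (a := B)) n
  rw [Set.union_compl_self, layerDensity_univ] at h
  linarith [layerDensity_nonneg Bᶜ n]

theorem layerDensity_mul_of_le [Nonempty A] (B : Set (FreeMonoid A)) (a : A) (n : ℕ) :
    layerDensity {w | w * FreeMonoid.of a ∈ B} n ≤ Fintype.card A * layerDensity B (n + 1) := by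
  have hq : (Fintype.card A : ℝ) ≠ 0 := by exact_mod_cast Fintype.card_ne_zero
  have h : (layer {w | w * FreeMonoid.of a ∈ B} n).ncard ≤ (layer B (n + 1)).ncard := by
    refine Set.ncard_le_ncard_of_injOn (fun w => w * FreeMonoid.of a) ?_
      (fun x _ y _ h => mul_right_cancel h) (finite_layer _ _)
    rintro w ⟨h1, h2⟩
    exact ⟨h1, by rw [FreeMonoid.length_mul, FreeMonoid.length_of, h2]⟩
  have h' : ((layer {w | w * FreeMonoid.of a ∈ B} n).ncard : ℝ) ≤ (layer B (n + 1)).ncard := by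
    exact_mod_cast h
  have h3 : (Fintype.card A : ℝ) * layerDensity B (n + 1) =
      (layer B (n + 1)).ncard / (Fintype.card A : ℝ) ^ n := by
    rw [layerDensity, pow_succ]
    field_simp
  rw [h3, layerDensity]
  gcongr

end wordAvg

/-- A finitely additive probability on words that is invariant under the removal of the first
letter, is not far from invariant under the removal of the last letter, and is bounded by the
largest layer density. -/
structure IsWordMean {A : Type*} [Fintype A] (m : Set (FreeMonoid A) → ℝ) : Prop where
  nonneg : ∀ B, 0 ≤ m B
  univ : m Set.univ = 1
  union : ∀ B C, Disjoint B C → m (B ∪ C) = m B + m C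
  left : ∀ B, m B = (∑ a : A, m (leftQuotient B (FreeMonoid.of a))) / Fintype.card A
  right_le : ∀ B (a : A), m {w | w * FreeMonoid.of a ∈ B} ≤ Fintype.card A * m B
  exists_layer : ∀ B c, c < m B → ∃ n, c < layerDensity B n

/-! ### Construction of an invariant mean -/

section intervalDensity

variable {A : Type*} [Fintype A] [Nonempty A]

theorem intervalDensity_mem_Icc (B : Set (FreeMonoid A)) (m L : ℕ) :
    intervalDensity B m L ∈ Set.Icc (0 : ℝ) 1 := by
  constructor
  · exact div_nonneg (Finset.sum_nonneg fun n _ => layerDensity_nonneg B n) (Nat.cast_nonneg L)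
  · refine div_le_one_of_le₀ ?_ (Nat.cast_nonneg L)
    calc ∑ n ∈ Finset.Ico m (m + L), layerDensity B n
        ≤ ∑ n ∈ Finset.Ico m (m + L), (1 : ℝ) := by
          gcongr; exact layerDensity_le_one B _
      _ = L := by simp

theorem exists_ultrafilter_tendsto_upperBanachDensity (S : Set (FreeMonoid A)) :
    ∃ U : Ultrafilter (ℕ × ℕ), (U : Filter (ℕ × ℕ)) ≤ atTop ×ˢ atTop ∧
      Tendsto (fun p : ℕ × ℕ => intervalDensity S p.1 p.2) U (nhds (upperBanachDensity S)) := by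
  rw [← mapClusterPt_iff_ultrafilter, mapClusterPt_iff_frequently]
  intro s hs
  obtain ⟨ε, hε, hs⟩ := Metric.mem_nhds_iff.1 hs
  have hbdd : IsBoundedUnder (· ≤ ·) (atTop ×ˢ atTop : Filter (ℕ × ℕ))
      fun p => intervalDensity S p.1 p.2 :=
    isBoundedUnder_of ⟨1, fun p => (intervalDensity_mem_Icc S p.1 p.2).2⟩
  have hcobdd : IsCoboundedUnder (· ≤ ·) (atTop ×ˢ atTop : Filter (ℕ × ℕ))
      fun p => intervalDensity S p.1 p.2 :=
    (isBoundedUnder_of ⟨0, fun p => (intervalDensity_mem_Icc S p.1 p.2).1⟩).isCoboundedUnder_le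
  have h1 := frequently_lt_of_lt_limsup hcobdd
    (show upperBanachDensity S - ε < upperBanachDensity S by linarith)
  have h2 := eventually_lt_of_limsup_lt
    (show upperBanachDensity S < upperBanachDensity S + ε by linarith) hbdd
  refine (h1.and_eventually h2).mono ?_
  rintro p ⟨h3, h4⟩
  apply hs
  rw [Metric.mem_ball, Real.dist_eq, abs_lt]
  constructor <;> linarith

theorem abs_intervalDensity_sub_le (B : Set (FreeMonoid A)) (m L : ℕ) :
    |(∑ n ∈ Finset.Ico m (m + L), layerDensity B (n + 1)) / (L : ℝ) - intervalDensity B m L|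
      ≤ 1 / L := by
  have h : ∑ n ∈ Finset.Ico m (m + L), layerDensity B (n + 1) -
      ∑ n ∈ Finset.Ico m (m + L), layerDensity B n =
        layerDensity B (m + L) - layerDensity B m := by
    rw [← Finset.sum_sub_distrib, Finset.sum_Ico_eq_sum_range, Nat.add_sub_cancel_left]
    exact Finset.sum_range_sub (fun i => layerDensity B (m + i)) L
  rw [intervalDensity, ← sub_div, h, abs_div, Nat.abs_cast]
  gcongr
  rw [abs_le]
  have h1 := layerDensity_le_one B (m + L)
  have h2 := layerDensity_le_one B m
  have h3 := layerDensity_nonneg B (m + L)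
  have h4 := layerDensity_nonneg B m
  constructor <;> linarith

/-- All interval densities lie in `[0, 1]`, so along one ultrafilter they converge for every set at
once. Shifting an interval of length `L` by one changes the density by at most `1 / L`, which
vanishes in the limit and gives invariance. -/
theorem exists_isWordMean (S : Set (FreeMonoid A)) :
    ∃ m : Set (FreeMonoid A) → ℝ, IsWordMean m ∧ m S = upperBanachDensity S := by
  obtain ⟨U, hU, hS⟩ := exists_ultrafilter_tendsto_upperBanachDensity S
  have hlim (B : Set (FreeMonoid A)) :
      ∃ x, Tendsto (fun p : ℕ × ℕ => intervalDensity B p.1 p.2) U (nhds x) := by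
    obtain ⟨x, -, hx⟩ := isCompact_Icc.ultrafilter_le_nhds
      (U.map fun p : ℕ × ℕ => intervalDensity B p.1 p.2)
      (le_principal_iff.2 (Filter.mem_map.2 (univ_mem' fun p => intervalDensity_mem_Icc B p.1 p.2)))
    exact ⟨x, hx⟩
  choose m hm using hlim
  have hsnd : Tendsto (fun p : ℕ × ℕ => p.2) U atTop := tendsto_snd.mono_left hU
  have hinv : Tendsto (fun p : ℕ × ℕ => 1 / (p.2 : ℝ)) U (nhds 0) :=
    (tendsto_one_div_atTop_nhds_zero_nat (𝕜 := ℝ)).comp hsnd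
  have hshift (B : Set (FreeMonoid A)) : Tendsto (fun p : ℕ × ℕ =>
      (∑ n ∈ Finset.Ico p.1 (p.1 + p.2), layerDensity B (n + 1)) / (p.2 : ℝ)) U (nhds (m B)) := by
    have h := squeeze_zero_norm (f := fun p : ℕ × ℕ =>
      (∑ n ∈ Finset.Ico p.1 (p.1 + p.2), layerDensity B (n + 1)) / (p.2 : ℝ) -
        intervalDensity B p.1 p.2) (fun p => abs_intervalDensity_sub_le B p.1 p.2) hinv
    simpa using h.add (hm B)
  refine ⟨m, ⟨?_, ?_, ?_, ?_, ?_, ?_⟩, tendsto_nhds_unique (hm S) hS⟩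
  · exact fun B => ge_of_tendsto' (hm B) fun p => (intervalDensity_mem_Icc B p.1 p.2).1
  · refine tendsto_nhds_unique (hm _) (tendsto_const_nhds.congr' ?_)
    filter_upwards [hsnd.eventually_ge_atTop 1] with p hp
    have : (p.2 : ℝ) ≠ 0 := by exact_mod_cast (by omega : p.2 ≠ 0)
    simp [intervalDensity, layerDensity_univ, this]
  · intro B C h
    refine tendsto_nhds_unique (hm _) (((hm B).add (hm C)).congr fun p => ?_)
    simp only [intervalDensity, layerDensity_union h, Finset.sum_add_distrib, add_div]
  · intro B
    refine tendsto_nhds_unique (hshift B) (Tendsto.congr (fun p => ?_)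
      ((tendsto_finsetSum Finset.univ fun a _ =>
        hm (leftQuotient B (FreeMonoid.of a))).div_const (Fintype.card A : ℝ)))
    simp only [intervalDensity, layerDensity_succ, ← Finset.sum_div]
    rw [Finset.sum_comm, div_right_comm]
  · intro B a
    refine le_of_tendsto_of_tendsto' (hm _) ((hshift B).const_mul _) fun p => ?_
    rw [intervalDensity, ← mul_div_assoc, Finset.mul_sum]
    gcongr with n
    exact layerDensity_mul_of_le B a n
  · intro B c hc
    by_contra! h
    have hc0 : 0 ≤ c := (layerDensity_nonneg B 0).trans (h 0)
    refine hc.not_ge (le_of_tendsto' (hm B) fun p => ?_)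
    refine div_le_of_le_mul₀ (Nat.cast_nonneg _) hc0 ?_
    calc ∑ n ∈ Finset.Ico p.1 (p.1 + p.2), layerDensity B n
        ≤ ∑ n ∈ Finset.Ico p.1 (p.1 + p.2), c := by gcongr; exact h _
      _ = c * p.2 := by simp [mul_comm]

end intervalDensity

/-! ### Finite additivity and means of left quotients -/

namespace IsWordMean

variable {A : Type*} [Fintype A] {m : Set (FreeMonoid A) → ℝ}

theorem mono (hm : IsWordMean m) {B C : Set (FreeMonoid A)} (h : B ⊆ C) : m B ≤ m C := by
  rw [← Set.union_sdiff_cancel h, hm.union _ _ Set.disjoint_sdiff_right]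
  linarith [hm.nonneg (C \ B)]

theorem le_one (hm : IsWordMean m) (B : Set (FreeMonoid A)) : m B ≤ 1 :=
  hm.univ ▸ hm.mono (Set.subset_univ B)

theorem empty (hm : IsWordMean m) : m ∅ = 0 := by
  have h := hm.union ∅ ∅ (by simp)
  rw [Set.union_empty] at h
  linarith

theorem inter_add_diff (hm : IsWordMean m) (B C : Set (FreeMonoid A)) :
    m (B ∩ C) + m (B \ C) = m B := by
  rw [← hm.union _ _ Set.disjoint_sdiff_inter.symm, Set.inter_union_sdiff]

theorem compl (hm : IsWordMean m) (B : Set (FreeMonoid A)) : m Bᶜ = 1 - m B := by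
  have h := hm.union B Bᶜ disjoint_compl_right
  rw [Set.union_compl_self, hm.univ] at h
  linarith

theorem union_le (hm : IsWordMean m) (B C : Set (FreeMonoid A)) : m (B ∪ C) ≤ m B + m C := by
  rw [← Set.union_sdiff_self, hm.union _ _ Set.disjoint_sdiff_right]
  linarith [hm.mono (Set.sdiff_subset : C \ B ⊆ C)]

theorem biUnion_le (hm : IsWordMean m) {ι : Type*} (s : Finset ι)
    (B : ι → Set (FreeMonoid A)) : m (⋃ i ∈ s, B i) ≤ ∑ i ∈ s, m (B i) := by
  classical
  induction s using Finset.induction_on with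
  | empty => simp [hm.empty]
  | insert i s hi ih =>
    rw [Finset.set_biUnion_insert, Finset.sum_insert hi]
    exact (hm.union_le _ _).trans (by gcongr)

theorem biUnion_eq (hm : IsWordMean m) {ι : Type*} (s : Finset ι)
    (B : ι → Set (FreeMonoid A)) (h : (s : Set ι).PairwiseDisjoint B) :
    m (⋃ i ∈ s, B i) = ∑ i ∈ s, m (B i) := by
  classical
  induction s using Finset.induction_on with
  | empty => simp [hm.empty]
  | insert i s hi ih =>
    rw [Finset.set_biUnion_insert, Finset.sum_insert hi, hm.union, ih]
    · exact h.subset (by simp)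
    · rw [Set.disjoint_iUnion₂_right]
      intro j hj
      exact h (by simp) (by simp [hj]) (by rintro rfl; exact hi hj)

/-- The mean of a sum of indicators is bounded by a pointwise bound. -/
theorem sum_le_of_card_le (hm : IsWordMean m) {ι : Type*} [DecidableEq ι] (s : Finset ι)
    (B : ι → Set (FreeMonoid A)) (t : ℕ)
    (h : ∀ x, ∀ X ⊆ s, (∀ i ∈ X, x ∈ B i) → X.card ≤ t) :
    ∑ i ∈ s, m (B i) ≤ t := by
  classical
  -- Words are grouped by the exact set `X` of indices `i` with `x ∈ B i`; only atoms with `X.card ≤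
  -- t` are nonempty.
  let atom (X : Finset ι) : Set (FreeMonoid A) := {x | s.filter (fun i => x ∈ B i) = X}
  have hdisj (I : Set (Finset ι)) : I.PairwiseDisjoint atom := by
    intro X _ Y _ hXY
    rw [Function.onFun, Set.disjoint_left]
    intro x hx hy
    exact hXY (hx.symm.trans hy)
  have hB (i) (hi : i ∈ s) : m (B i) = ∑ X ∈ s.powerset, if i ∈ X then m (atom X) else 0 := by
    rw [← Finset.sum_filter, ← hm.biUnion_eq _ _ (hdisj _)]
    congr 1
    ext x
    simp only [Set.mem_iUnion, Finset.mem_filter, Finset.mem_powerset, exists_prop]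
    constructor
    · intro hx
      exact ⟨_, ⟨Finset.filter_subset _ _, Finset.mem_filter.2 ⟨hi, hx⟩⟩, rfl⟩
    · rintro ⟨X, ⟨-, hiX⟩, hx⟩
      have hx : s.filter (fun i => x ∈ B i) = X := hx
      rw [← hx] at hiX
      exact (Finset.mem_filter.1 hiX).2
  rw [Finset.sum_congr rfl hB, Finset.sum_comm]
  have htot : ∑ X ∈ s.powerset, m (atom X) = 1 := by
    rw [← hm.biUnion_eq _ _ (hdisj _), ← hm.univ]
    congr 1
    ext x
    simp only [Set.mem_iUnion, Finset.mem_powerset, exists_prop, Set.mem_univ, iff_true]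
    exact ⟨_, Finset.filter_subset _ _, rfl⟩
  calc ∑ X ∈ s.powerset, ∑ i ∈ s, (if i ∈ X then m (atom X) else 0)
      ≤ ∑ X ∈ s.powerset, t * m (atom X) := by
        refine Finset.sum_le_sum fun X hX => ?_
        rw [← Finset.sum_filter, Finset.sum_const, nsmul_eq_mul]
        have hsX : s.filter (· ∈ X) = X := by
          rw [Finset.filter_mem_eq_inter, Finset.inter_eq_right.2 (Finset.mem_powerset.1 hX)]
        rw [hsX]
        rcases Set.eq_empty_or_nonempty (atom X) with h0 | ⟨x, hx⟩
        · simp [h0, hm.empty]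
        · have : X.card ≤ t := by
            refine h x X (Finset.mem_powerset.1 hX) fun i hi => ?_
            have hx : s.filter (fun i => x ∈ B i) = X := hx
            rw [← hx] at hi
            exact (Finset.mem_filter.1 hi).2
          have h1 := hm.nonneg (atom X)
          gcongr
    _ = t := by rw [← Finset.mul_sum, htot, mul_one]

theorem eq_wordAvg (hm : IsWordMean m) (n : ℕ) (B : Set (FreeMonoid A)) :
    m B = wordAvg n fun v => m (leftQuotient B v) := by
  induction n generalizing B with
  | zero => rw [wordAvg, leftQuotient_one]
  | succ n ih =>
    rw [hm.left B, wordAvg]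
    simp only [← leftQuotient_leftQuotient, ← ih]

theorem leftQuotient_le [Nonempty A] (hm : IsWordMean m) (B : Set (FreeMonoid A))
    (u : FreeMonoid A) :
    m (leftQuotient B u) ≤ (Fintype.card A : ℝ) ^ u.length * m B := by
  have hq : (0 : ℝ) < (Fintype.card A : ℝ) ^ u.length :=
    pow_pos (by exact_mod_cast Fintype.card_pos) _
  rw [mul_comm, ← div_le_iff₀ hq]
  conv_rhs => rw [hm.eq_wordAvg u.length]
  exact le_wordAvg (fun w => hm.nonneg _) u

theorem leftQuotient_eq_zero [Nonempty A] (hm : IsWordMean m) {B : Set (FreeMonoid A)}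
    (h : m B = 0) (u : FreeMonoid A) : m (leftQuotient B u) = 0 :=
  le_antisymm (by simpa [h] using hm.leftQuotient_le B u) (hm.nonneg _)

end IsWordMean

/-! ### Negligible sets and chains of nearly disjoint cones -/

/-- The largest mean of a left quotient of `S`. -/
noncomputable def supMean {A : Type*} (m : Set (FreeMonoid A) → ℝ) (S : Set (FreeMonoid A)) : ℝ :=
  ⨆ u, m (leftQuotient S u)

/-- `P` is negligible if it has small mean in every cone in which `S` is nearly as dense as
possible. -/
def IsNegligible {A : Type*} (m : Set (FreeMonoid A) → ℝ) (S P : Set (FreeMonoid A)) : Prop :=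
  ∀ c > 0, ∃ η > 0, ∀ u, supMean m S - η ≤ m (leftQuotient S u) → m (leftQuotient P u) < c

theorem exists_supMean_sub_lt {A : Type*} (m : Set (FreeMonoid A) → ℝ) (S : Set (FreeMonoid A)) {η : ℝ}
    (hη : 0 < η) : ∃ u, supMean m S - η < m (leftQuotient S u) :=
  exists_lt_of_lt_ciSup (f := fun u => m (leftQuotient S u)) (sub_lt_self _ hη)

theorem not_isNegligible_self {A : Type*} {m : Set (FreeMonoid A) → ℝ} {S : Set (FreeMonoid A)}
    (h : 0 < supMean m S) : ¬ IsNegligible m S S := by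
  intro H
  obtain ⟨η, hη, H⟩ := H (supMean m S / 2) (by positivity)
  obtain ⟨u, hu⟩ := exists_supMean_sub_lt m S
    (lt_min hη (show 0 < supMean m S / 2 by positivity))
  have h1 := H u (by linarith [min_le_left η (supMean m S / 2)])
  linarith [min_le_right η (supMean m S / 2)]

section Negligible

variable {A : Type*} [Fintype A] {m : Set (FreeMonoid A) → ℝ} {S P Q : Set (FreeMonoid A)}

theorem le_supMean (hm : IsWordMean m) (S : Set (FreeMonoid A)) (u : FreeMonoid A) :
    m (leftQuotient S u) ≤ supMean m S :=
  le_ciSup (f := fun u => m (leftQuotient S u))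
    ⟨1, by rintro _ ⟨u, rfl⟩; exact hm.le_one _⟩ u

theorem IsNegligible.mono (hm : IsWordMean m) (hQ : IsNegligible m S Q) (h : P ⊆ Q) :
    IsNegligible m S P := by
  intro c hc
  obtain ⟨η, hη, H⟩ := hQ c hc
  exact ⟨η, hη, fun u hu => (hm.mono (show leftQuotient P u ⊆ leftQuotient Q u from
    fun w hw => h hw)).trans_lt (H u hu)⟩

theorem IsNegligible.union (hm : IsWordMean m) (hP : IsNegligible m S P)
    (hQ : IsNegligible m S Q) : IsNegligible m S (P ∪ Q) := by
  intro c hc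
  obtain ⟨η₁, hη₁, H₁⟩ := hP (c / 2) (by positivity)
  obtain ⟨η₂, hη₂, H₂⟩ := hQ (c / 2) (by positivity)
  refine ⟨min η₁ η₂, lt_min hη₁ hη₂, fun u hu => ?_⟩
  have h1 := H₁ u (by linarith [min_le_left η₁ η₂])
  have h2 := H₂ u (by linarith [min_le_right η₁ η₂])
  have h3 : m (leftQuotient (P ∪ Q) u) ≤ m (leftQuotient P u) + m (leftQuotient Q u) :=
    hm.union_le _ _
  linarith

theorem isNegligible_empty (hm : IsWordMean m) : IsNegligible m S ∅ := by
  intro c hc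
  refine ⟨1, one_pos, fun u _ => ?_⟩
  have : leftQuotient (∅ : Set (FreeMonoid A)) u = ∅ := rfl
  rwa [this, hm.empty]

theorem isNegligible_biUnion (hm : IsWordMean m) {ι : Type*} (s : Finset ι)
    {B : ι → Set (FreeMonoid A)} (h : ∀ i ∈ s, IsNegligible m S (B i)) :
    IsNegligible m S (⋃ i ∈ s, B i) := by
  classical
  induction s using Finset.induction_on with
  | empty => simpa using isNegligible_empty hm
  | insert i s hi ih =>
    rw [Finset.set_biUnion_insert]
    exact (h i (by simp)).union hm (ih fun j hj => h j (by simp [hj]))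

theorem not_isNegligible_diff (hm : IsWordMean m) (hP : ¬ IsNegligible m S P)
    (hQ : IsNegligible m S Q) : ¬ IsNegligible m S (P \ Q) := fun h =>
  hP ((h.union hm hQ).mono hm (by rw [Set.sdiff_union_self]; exact Set.subset_union_left))

theorem nonempty_of_not_isNegligible (hm : IsWordMean m) (hP : ¬ IsNegligible m S P) :
    P.Nonempty := by
  rw [Set.nonempty_iff_ne_empty]
  rintro rfl
  exact hP (isNegligible_empty hm)

/-- In a cone in which `S` is nearly as dense as possible, most words `s` are such that `S` is
nearly as dense as possible in the cone of `s * w`. -/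
theorem isNegligible_setOf_lt [Nonempty A] (hm : IsWordMean m) (w : FreeMonoid A) {δ : ℝ}
    (hδ : 0 < δ) : IsNegligible m S {s | m (leftQuotient S (s * w)) < supMean m S - δ} := by
  intro c hc
  have hq : (0 : ℝ) < (Fintype.card A : ℝ) ^ w.length :=
    pow_pos (by exact_mod_cast Fintype.card_pos) _
  set q : ℝ := (Fintype.card A : ℝ) ^ w.length
  -- The deficits `M - m (S/x)` are nonnegative and average to the deficit at `u`. Each bad `v`
  -- gives the cone of `u * v * w` a deficit above `δ`, with weight `1 / q` among the continuations
  -- of `v`. A layer with more than a fraction `c / 2` of bad words would thus exceed the allowed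
  -- deficit.
  refine ⟨c / 2 * δ / q, by positivity, fun u hu => ?_⟩
  by_contra! h
  obtain ⟨n, hn⟩ := hm.exists_layer _ (c / 2) ((half_lt_self hc).trans_le h)
  rw [layerDensity_eq_wordAvg] at hn
  set M := supMean m S
  set B := leftQuotient {s | m (leftQuotient S (s * w)) < M - δ} u with hB
  have h1 : M - m (leftQuotient S u) =
      wordAvg n fun v => wordAvg w.length fun x => M - m (leftQuotient S (u * (v * x))) := by
    rw [← wordAvg_add n w.length fun x => M - m (leftQuotient S (u * x)), wordAvg_sub,
      wordAvg_const, hm.eq_wordAvg (n + w.length)]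
    simp only [leftQuotient_leftQuotient]
  have h2 : wordAvg n (fun v => δ / q * B.indicator 1 v) ≤ M - m (leftQuotient S u) := by
    rw [h1]
    refine wordAvg_mono fun v => ?_
    have h0 : ∀ x, 0 ≤ M - m (leftQuotient S (u * (v * x))) := fun x =>
      sub_nonneg.2 (le_supMean hm S _)
    by_cases hv : v ∈ B
    · refine le_trans ?_ (le_wordAvg h0 w)
      have hv' : m (leftQuotient S (u * v * w)) < M - δ := hv
      rw [Set.indicator_of_mem hv, Pi.one_apply, mul_one]
      gcongr
      rw [← mul_assoc]
      linarith
    · rw [Set.indicator_of_notMem hv, mul_zero]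
      exact wordAvg_nonneg h0
  rw [wordAvg_const_mul] at h2
  have h3 : δ / q * (c / 2) < δ / q * wordAvg n (B.indicator 1) := by gcongr
  have h4 : δ / q * (c / 2) = c / 2 * δ / q := by ring
  linarith

/-- If for each `s` in a non-negligible set there are many `x` with `s * w * x ∈ B`, then `B` is
not negligible. -/
theorem isNegligible_of_mul [Nonempty A] (hm : IsWordMean m) {B : Set (FreeMonoid A)}
    (hB : IsNegligible m S B) (w : FreeMonoid A) {c : ℝ} (hc : 0 < c)
    (h : ∀ s ∈ P, c ≤ m (leftQuotient B (s * w))) : IsNegligible m S P := by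
  intro ε hε
  have hq : (0 : ℝ) < (Fintype.card A : ℝ) ^ w.length :=
    pow_pos (by exact_mod_cast Fintype.card_pos) _
  set q : ℝ := (Fintype.card A : ℝ) ^ w.length
  obtain ⟨η, hη, H⟩ := hB (c / q * (ε / 2)) (by positivity)
  refine ⟨η, hη, fun u hu => ?_⟩
  by_contra! hcon
  obtain ⟨n, hn⟩ := hm.exists_layer _ (ε / 2) ((half_lt_self hε).trans_le hcon)
  rw [layerDensity_eq_wordAvg] at hn
  refine (H u hu).not_ge ?_
  rw [hm.eq_wordAvg (n + w.length), wordAvg_add]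
  calc c / q * (ε / 2) ≤ c / q * wordAvg n ((leftQuotient P u).indicator 1) := by gcongr
    _ = wordAvg n fun v => c / q * (leftQuotient P u).indicator 1 v :=
      (wordAvg_const_mul _ _ _).symm
    _ ≤ _ := by
      refine wordAvg_mono fun v => ?_
      by_cases hv : v ∈ leftQuotient P u
      · refine le_trans ?_ (le_wordAvg (fun x => hm.nonneg _) w)
        rw [Set.indicator_of_mem hv, Pi.one_apply, mul_one]
        gcongr
        rw [leftQuotient_leftQuotient, ← mul_assoc]
        exact h _ hv
      · rw [Set.indicator_of_notMem hv, mul_zero]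
        exact wordAvg_nonneg fun x => hm.nonneg _

/-- A long sequence of words, each obtained from the previous one by multiplying with `h` elements
of `P` on the left, such that `S` is nearly as dense as possible in all of their cones and nearly
disjoint in those pairs of cones whose index difference is in `C`. -/
theorem exists_chain_of_isNegligible [Nonempty A] (hm : IsWordMean m) (hP : ¬ IsNegligible m S P)
    {C : Set ℕ} {h : ℕ} (hh : 0 < h)
    (hC : ∀ c ∈ C, 0 < c → IsNegligible m S (S ∩ (P ^ (h * c) * S))) {δ : ℝ} (hδ : 0 < δ) (n : ℕ) :
    ∃ t : ℕ → FreeMonoid A, (∀ i ≤ n, supMean m S - δ ≤ m (leftQuotient S (t i))) ∧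
      (∀ i j, i ≤ j → j ≤ n → ∃ p ∈ P ^ (h * (j - i)), t j = p * t i) ∧
      ∀ i j, i < j → j ≤ n → j - i ∈ C →
        m (leftQuotient S (t i) ∩ leftQuotient S (t j)) < δ := by
  classical
  induction n with
  | zero =>
    obtain ⟨u, hu⟩ := exists_supMean_sub_lt m S hδ
    refine ⟨fun _ => u, fun _ _ => hu.le, fun i j _ _ => ⟨1, ?_, by simp⟩, fun i j _ _ => by omega⟩
    rw [show j - i = 0 by omega, mul_zero, pow_zero]
    exact Set.one_mem_one
  | succ n ih =>
    obtain ⟨t, h1, h2, h3⟩ := ih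
    obtain ⟨s₀, hs₀⟩ := nonempty_of_not_isNegligible hm hP
    have hmem {s : FreeMonoid A} (hs : s ∈ P) {i : ℕ} (hi : i ≤ n) :
        ∃ p ∈ P ^ (h * (n + 1 - i)), s * (s₀ ^ (h - 1) * t n) = p * t i := by
      obtain ⟨p, hp, hpt⟩ := h2 i n hi le_rfl
      refine ⟨s * s₀ ^ (h - 1) * p, ?_, by rw [hpt]; simp only [mul_assoc]⟩
      have hsum : h * (n + 1 - i) = 1 + (h - 1) + h * (n - i) := by
        rw [show n + 1 - i = (n - i) + 1 by omega, mul_add]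
        omega
      rw [hsum, pow_add, pow_add, pow_one]
      exact Set.mul_mem_mul (Set.mul_mem_mul hs (Set.pow_mem_pow hs₀)) hp
    -- Of the `h` new factors only the leftmost is chosen; the others are the fixed `s₀`. Hence it
    -- suffices that one element of `P` avoids finitely many negligible sets.
    set w := s₀ ^ (h - 1) * t n
    let Z (i : ℕ) : Set (FreeMonoid A) :=
      {s ∈ P | δ ≤ m (leftQuotient S (t i) ∩ leftQuotient S (s * w))}
    have hZ : ∀ i ∈ (Finset.range (n + 1)).filter (fun i => n + 1 - i ∈ C),
        IsNegligible m S (Z i) := by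
      intro i hi
      rw [Finset.mem_filter, Finset.mem_range] at hi
      refine isNegligible_of_mul hm (hC _ hi.2 (by omega)) w hδ ?_
      rintro s ⟨hs, hs'⟩
      refine hs'.trans (hm.mono ?_)
      rintro x ⟨hx1, hx2⟩
      obtain ⟨p, hp, hpt⟩ := hmem hs (i := i) (by omega)
      refine ⟨hx2, Set.mem_mul.2 ⟨p, hp, t i * x, hx1, ?_⟩⟩
      rw [← mul_assoc, ← hpt]
    obtain ⟨s, hs, hs'⟩ := nonempty_of_not_isNegligible hm
      (not_isNegligible_diff hm hP
        ((isNegligible_setOf_lt hm w hδ).union hm (isNegligible_biUnion hm _ hZ)))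
    rw [Set.mem_union, not_or] at hs'
    obtain ⟨hs1, hs2⟩ := hs'
    have hs1 : supMean m S - δ ≤ m (leftQuotient S (s * w)) := not_lt.1 hs1
    refine ⟨fun i => if i ≤ n then t i else s * w, ?_, ?_, ?_⟩
    · intro i _
      by_cases hi : i ≤ n
      · simpa only [hi, if_true] using h1 i hi
      · simpa only [hi, if_false] using hs1
    · intro i j hij hj
      by_cases hjn : j ≤ n
      · simpa only [hjn, hij.trans hjn, if_true] using h2 i j hij hjn
      · obtain rfl : j = n + 1 := by omega
        by_cases hi : i ≤ n
        · simpa only [hi, hjn, if_true, if_false] using hmem hs hi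
        · refine ⟨1, ?_, by simp only [hi, hjn, if_false, one_mul]⟩
          rw [show n + 1 - i = 0 by omega, mul_zero, pow_zero]
          exact Set.one_mem_one
    · intro i j hij hj hijC
      by_cases hjn : j ≤ n
      · simpa only [hjn, hij.le.trans hjn, if_true] using h3 i j hij hjn hijC
      · obtain rfl : j = n + 1 := by omega
        have hi : i ≤ n := by omega
        simp only [hi, hjn, if_true, if_false]
        by_contra! hcon
        refine hs2 (Set.mem_iUnion₂.2 ⟨i, ?_, hs, hcon⟩)
        rw [Finset.mem_filter, Finset.mem_range]
        exact ⟨by omega, hijC⟩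

/-- If sets of integers avoiding all differences in `C` are sparser than `S`, then there are many
elements of `S` that arise from an element of `S` by multiplying with `h * c` elements of `P` on
the left, for some `c ∈ C`. -/
theorem exists_not_isNegligible_pow_mul [Nonempty A] (hm : IsWordMean m)
    (hP : ¬ IsNegligible m S P) {C : Set ℕ} {h n t : ℕ} (hh : 0 < h)
    (hX : ∀ X ⊆ Finset.range n, (∀ i ∈ X, ∀ j ∈ X, i < j → j - i ∉ C) → X.card ≤ t)
    (ht : t < n * supMean m S) :
    ∃ c ∈ C, 0 < c ∧ ¬ IsNegligible m S (S ∩ (P ^ (h * c) * S)) := by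
  classical
  by_contra! hC
  have hn : 0 < n := by
    rcases Nat.eq_zero_or_pos n with rfl | hn
    · have : (0 : ℝ) ≤ t := t.cast_nonneg
      simp at ht
      linarith
    · exact hn
  have hn' : (0 : ℝ) < n := by exact_mod_cast hn
  set M := supMean m S
  -- Each of the `n` cones loses at most `δ + n²δ` when the overlaps `Z` are removed; this `δ` makes
  -- the total loss `(nM - t) / 2`.
  set δ : ℝ := (n * M - t) / (2 * (n * (1 + n * n))) with hδ_def
  have hδ : 0 < δ := div_pos (by linarith) (by positivity)
  obtain ⟨u, h1, -, h3⟩ := exists_chain_of_isNegligible hm hP hh hC hδ (n - 1)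
  let D (i : ℕ) := leftQuotient S (u i)
  let I := (Finset.range n ×ˢ Finset.range n).filter fun p => p.1 < p.2 ∧ p.2 - p.1 ∈ C
  let Z : Set (FreeMonoid A) := ⋃ p ∈ I, D p.1 ∩ D p.2
  have hZ : m Z ≤ n * n * δ := by
    refine (hm.biUnion_le _ _).trans ?_
    calc ∑ p ∈ I, m (D p.1 ∩ D p.2) ≤ ∑ p ∈ I, δ := by
          refine Finset.sum_le_sum fun p hp => ?_
          obtain ⟨hp1, hp2, hp3⟩ := Finset.mem_filter.1 hp
          have hp4 := (Finset.mem_product.1 hp1).2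
          rw [Finset.mem_range] at hp4
          exact (h3 p.1 p.2 hp2 (by omega) hp3).le
      _ = I.card * δ := by rw [Finset.sum_const, nsmul_eq_mul]
      _ ≤ n * n * δ := by
          gcongr
          have := Finset.card_filter_le (Finset.range n ×ˢ Finset.range n)
            fun p => p.1 < p.2 ∧ p.2 - p.1 ∈ C
          rw [Finset.card_product, Finset.card_range] at this
          exact_mod_cast this
  have hsum : ∑ i ∈ Finset.range n, m (D i \ Z) ≤ t := by
    refine hm.sum_le_of_card_le _ _ t fun x X hXs hx => hX X hXs fun i hi j hj hij hijC => ?_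
    refine (hx i hi).2 (Set.mem_iUnion₂.2 ⟨(i, j), ?_, (hx i hi).1, (hx j hj).1⟩)
    exact Finset.mem_filter.2 ⟨Finset.mem_product.2 ⟨hXs hi, hXs hj⟩, hij, hijC⟩
  have hlow : ∑ i ∈ Finset.range n, (M - δ - n * n * δ) ≤ ∑ i ∈ Finset.range n, m (D i \ Z) := by
    refine Finset.sum_le_sum fun i hi => ?_
    rw [Finset.mem_range] at hi
    have h5 : M - δ ≤ m (D i) := h1 i (by omega)
    have h6 := hm.inter_add_diff (D i) Z
    have h7 := hm.mono (Set.inter_subset_right : D i ∩ Z ⊆ Z)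
    linarith
  rw [Finset.sum_const, nsmul_eq_mul, Finset.card_range] at hlow
  have h8 : δ * (n * (1 + n * n)) = (n * M - t) / 2 := by
    rw [hδ_def]; field_simp
  nlinarith

end Negligible

/-! ### Integer sets with forbidden differences; product-freeness through powers of sets -/

theorem card_le_one_of_sub_notMem {n : ℕ} {X : Finset ℕ} (hX : X ⊆ Finset.range n)
    (h : ∀ i ∈ X, ∀ j ∈ X, i < j → j - i ∉ Set.Ico 1 n) : X.card ≤ 1 := by
  rw [Finset.card_le_one]
  intro i hi j hj
  have h1 := Finset.mem_range.1 (hX hi)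
  have h2 := Finset.mem_range.1 (hX hj)
  rcases lt_trichotomy i j with hij | hij | hij
  · exact absurd ⟨by omega, by omega⟩ (h i hi j hj hij)
  · exact hij
  · exact absurd ⟨by omega, by omega⟩ (h j hj i hi hij)

/-- Gaps are at least `ρ`, and `0` and `t * ρ` are not both in `X`. So `X` lies in an interval of `t
* ρ` integers, which splits into `t` blocks of length `ρ` with at most one element each. -/
theorem card_le_of_sub_notMem {ρ t : ℕ} (hρ : 0 < ρ) (ht : 0 < t) {X : Finset ℕ}
    (hX : X ⊆ Finset.range (t * ρ + 1))
    (h : ∀ i ∈ X, ∀ j ∈ X, i < j → j - i ∉ insert (t * ρ) (Set.Ico 1 ρ)) : X.card ≤ t := by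
  have hgap : ∀ i ∈ X, ∀ j ∈ X, i < j → i + ρ ≤ j := by
    intro i hi j hj hij
    by_contra hc
    exact h i hi j hj hij (Or.inr ⟨by omega, by omega⟩)
  obtain ⟨e, he⟩ : ∃ e, ∀ i ∈ X, e ≤ i ∧ i < e + t * ρ := by
    by_cases h0 : 0 ∈ X
    · refine ⟨0, fun i hi => ⟨by omega, ?_⟩⟩
      have h1 := Finset.mem_range.1 (hX hi)
      by_contra hc
      have h2 : i = t * ρ := by omega
      have h3 : 0 < t * ρ := Nat.mul_pos ht hρ
      exact h 0 h0 i hi (by omega) (Or.inl (by omega))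
    · refine ⟨1, fun i hi => ⟨?_, ?_⟩⟩
      · rcases Nat.eq_zero_or_pos i with rfl | h1
        · exact absurd hi h0
        · exact h1
      · have h1 := Finset.mem_range.1 (hX hi)
        omega
  have hinj : Set.InjOn (fun i => (i - e) / ρ) (X : Set ℕ) := by
    intro i hi j hj hij
    have key : ∀ i ∈ X, ∀ j ∈ X, i < j → (i - e) / ρ ≠ (j - e) / ρ := by
      intro i hi j hj hij hd
      have h1 := hgap i hi j hj hij
      have h2 := (he i hi).1
      have h3 : (i - e + ρ) / ρ ≤ (j - e) / ρ := Nat.div_le_div_right (by omega)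
      rw [Nat.add_div_right _ hρ] at h3
      omega
    rcases lt_trichotomy i j with hlt | hlt | hlt
    · exact absurd hij (key i hi j hj hlt)
    · exact hlt
    · exact absurd hij.symm (key j hj i hi hlt)
  rw [← Finset.card_image_of_injOn hinj, ← Finset.card_range t]
  refine Finset.card_le_card fun y hy => ?_
  obtain ⟨i, hi, rfl⟩ := Finset.mem_image.1 hy
  rw [Finset.mem_range, Nat.div_lt_iff_lt_mul hρ]
  have := he i hi
  omega

theorem isProductFree_iff {M : Type*} [Monoid M] {k : ℕ} {S : Set M} :
    IsProductFree k S ↔ Disjoint S (S ^ k) := by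
  rw [Set.disjoint_left]
  constructor
  · intro h x hx hxk
    obtain ⟨f, rfl⟩ := Set.mem_pow.1 hxk
    exact h (fun i => f i) (fun i => (f i).2) hx
  · intro h x hx hmem
    exact h hmem (Set.mem_pow.2 ⟨fun i => ⟨x i, hx i⟩, rfl⟩)

theorem IsProductFree.mono {M : Type*} [Monoid M] {k : ℕ} {S T : Set M} (h : IsProductFree k T)
    (hST : S ⊆ T) : IsProductFree k S := fun x hx hmem => h x (fun i => hST (hx i)) (hST hmem)

/-! ### Products of few elements are negligible in dense `k`-product-free sets -/

section

variable {A : Type*} [Fintype A] [Nonempty A] {m : Set (FreeMonoid A) → ℝ}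
  {S P : Set (FreeMonoid A)}

/-- If `supMean m S > 1 / n`, the engine with `P = S` and `C = {1, …, n - 1}` yields an element of
`S ∩ S ^ (c + 1)` with `c + 1 ≤ n`. -/
theorem supMean_le_of_isStronglyProductFree (hm : IsWordMean m) {n : ℕ} (hn : 0 < n)
    (hS : IsStronglyProductFree n S) : supMean m S ≤ 1 / n := by
  by_contra! hlt
  have hn' : (0 : ℝ) < n := by exact_mod_cast hn
  have hpos : 0 < supMean m S := lt_trans (by positivity) hlt
  rw [div_lt_iff₀ hn', mul_comm] at hlt
  obtain ⟨c, hc, -, hfat⟩ := exists_not_isNegligible_pow_mul hm (not_isNegligible_self hpos)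
    (C := Set.Ico 1 n) (t := 1) one_pos (fun X hX h => card_le_one_of_sub_notMem hX h)
    (by simpa using hlt)
  obtain ⟨x, hx, hx'⟩ := nonempty_of_not_isNegligible hm hfat
  rw [one_mul, ← pow_succ] at hx'
  exact Set.disjoint_left.1 (isProductFree_iff.1 (hS (c + 1) (by have := hc.1; omega) hc.2)) hx hx'

/-- A product of elements of `P`, each of which is a product of `1 + g * x` elements of `S` for
`x = 0` and for `b ≤ x ≤ B`, is a product of many possible numbers of elements of `S`. -/
theorem pow_subset_pow_of_subset {M : Type*} [Monoid M] {S P : Set M} {g b B : ℕ} (h₀ : P ⊆ S)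
    (h₁ : ∀ x ∈ Set.Icc b B, P ⊆ S ^ (1 + g * x)) (hbB : b ≤ B) :
    ∀ (c t z : ℕ), t ≤ c → t * b ≤ z → z ≤ t * B → P ^ c ⊆ S ^ (c + g * z) := by
  intro c
  induction c with
  | zero =>
    intro t z ht _ hz
    obtain rfl : t = 0 := by omega
    obtain rfl : z = 0 := by omega
    simp
  | succ c ih =>
    intro t z ht hz1 hz2
    rcases Nat.eq_zero_or_pos t with rfl | htpos
    · obtain rfl : z = 0 := by omega
      have h := ih 0 0 (by omega) (by omega) (by omega)
      rw [pow_succ, mul_zero, add_zero, pow_succ]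
      exact Set.mul_subset_mul (by simpa using h) h₀
    · obtain ⟨t, rfl⟩ : ∃ t', t = t' + 1 := ⟨t - 1, by omega⟩
      rw [add_mul, one_mul] at hz1 hz2
      obtain ⟨x, hx, hxz, hz3, hz4⟩ :
          ∃ x ∈ Set.Icc b B, x ≤ z ∧ t * b ≤ z - x ∧ z - x ≤ t * B := by
        -- One factor takes the least amount `b` if the other `t` can absorb the rest; otherwise
        -- those take their maximum `t * B`.
        by_cases hcase : z ≤ t * B + b
        · exact ⟨b, ⟨le_rfl, hbB⟩, by omega, by omega, by omega⟩
        · have := Nat.mul_le_mul_left t hbB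
          exact ⟨z - t * B, ⟨by omega, by omega⟩, by omega, by omega, by omega⟩
      have h := ih t (z - x) (by omega) hz3 hz4
      have hexp : c + 1 + g * z = (c + g * (z - x)) + (1 + g * x) := by
        obtain ⟨y, rfl⟩ := Nat.exists_eq_add_of_le hxz
        rw [Nat.add_sub_cancel_left]
        ring
      rw [pow_succ, hexp, pow_add S]
      exact Set.mul_subset_mul h (h₁ x hx)

/-- If `k - 1` is a large enough multiple of `g`, then `k`-product-free sets that are dense have
few elements that are products of `1 + g` elements. -/
theorem isNegligible_inter_pow (hm : IsWordMean m) {ρ K g k r : ℕ} (hρ : 0 < ρ) (hg : 0 < g)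
    (hk : k = 1 + g * K) (hS : IsProductFree k S) (hd : 1 / (ρ : ℝ) ≤ supMean m S) (hr : 0 < r)
    (hrK : ρ * r ≤ K)
    (hb : ∀ b, 0 < b → r ∣ b → b * (1 + g) < K →
      ∃ r' > 0, ρ * r' + b ≤ K ∧ K ≤ r' * (1 + g * (b * (1 + g)))) :
    IsNegligible m S (S ∩ S ^ (1 + g)) := by
  by_contra hfat
  have hρ' : (0 : ℝ) < ρ := by exact_mod_cast hρ
  have hpow {x : FreeMonoid A} (hx : x ∈ S) : x ∉ S ^ k :=
    Set.disjoint_left.1 (isProductFree_iff.1 hS) hx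
  set M := supMean m S
  have hM : 1 ≤ ρ * M := by
    rw [div_le_iff₀ hρ', mul_comm] at hd
    exact hd
  -- Forbidding the difference `t * ρ` in addition to `1, …, ρ - 1` lowers the density bound to `t /
  -- (tρ + 1)`, strictly below `1 / ρ`, so the engine applies even when `M = 1 / ρ`.
  have hmany (t : ℕ) (ht : 0 < t) : (t : ℝ) < (t * ρ + 1 : ℕ) * M := by
    have hMpos : 0 < M := lt_of_lt_of_le (by positivity) hd
    have : (t : ℝ) * 1 ≤ t * (ρ * M) := by gcongr
    push_cast
    nlinarith
  -- Take `t = ⌊K / (ρr)⌋`. Then `c = tρ` would give `b = tρr` with `b ≤ K ≤ b(1 + g)`, which `hnot`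
  -- excludes; so `c < ρ` will follow.
  obtain ⟨t, ht, htK, hKt⟩ : ∃ t, 0 < t ∧ t * ρ * r ≤ K ∧ K ≤ t * ρ * r * (1 + g) := by
    have hpos : 0 < ρ * r := Nat.mul_pos hρ hr
    refine ⟨K / (ρ * r), Nat.div_pos hrK hpos, ?_, ?_⟩
    · rw [mul_assoc]
      exact Nat.div_mul_le_self K _
    · have h1 := Nat.lt_div_mul_add hpos (a := K)
      have h2 : ρ * r ≤ K / (ρ * r) * (ρ * r) :=
        Nat.le_mul_of_pos_left _ (Nat.div_pos hrK hpos)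
      rw [mul_assoc (K / (ρ * r))]
      calc K ≤ K / (ρ * r) * (ρ * r) * (1 + 1) := by omega
        _ ≤ _ := by gcongr; exact hg
  have hP₀ : ∀ x ∈ Set.Icc 1 1, S ∩ S ^ (1 + g) ⊆ S ^ (1 + g * x) := by
    rintro x ⟨hx1, hx2⟩
    obtain rfl : x = 1 := by omega
    rw [mul_one]
    exact Set.inter_subset_right
  obtain ⟨c, hc, hcpos, hfat₁⟩ := exists_not_isNegligible_pow_mul hm hfat
    (C := insert (t * ρ) (Set.Ico 1 ρ)) (h := g * r) (Nat.mul_pos hg hr)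
    (fun X hX h => card_le_of_sub_notMem hρ ht hX h) (hmany t ht)
  set b := r * c with hb_def
  have hbpos : 0 < b := Nat.mul_pos hr hcpos
  rw [show g * r * c = g * b by rw [hb_def, mul_assoc]] at hfat₁
  set P := S ∩ ((S ∩ S ^ (1 + g)) ^ (g * b) * S) with hP_def
  -- Each of the `g * b` factors counts as `1` or as `1 + g` elements of `S`. Expanding `y` of them
  -- gives `1 + g(b + y)` in all, for any `y ≤ g * b`.
  have hP : ∀ x ∈ Set.Icc b (b * (1 + g)), P ⊆ S ^ (1 + g * x) := by
    rintro x ⟨hx1, hx2⟩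
    obtain ⟨y, rfl⟩ := Nat.exists_eq_add_of_le hx1
    have h1 := pow_subset_pow_of_subset Set.inter_subset_left hP₀ le_rfl (g * b) y y
      (by linarith [mul_comm b g, mul_add b 1 g]) (by omega) (by omega)
    refine Set.inter_subset_right.trans ?_
    rw [show 1 + g * (b + y) = (g * b + g * y) + 1 by ring, pow_succ]
    exact Set.mul_subset_mul_right h1
  obtain ⟨x₁, hx₁⟩ := nonempty_of_not_isNegligible hm hfat₁
  have hnot : ¬ (b ≤ K ∧ K ≤ b * (1 + g)) := by
    rintro ⟨h1, h2⟩
    refine hpow hx₁.1 ?_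
    rw [hk]
    exact hP K ⟨h1, h2⟩ hx₁
  have hbK : b * (1 + g) < K := by
    have h1 : b ≤ K := by
      rcases hc with rfl | hc
      · rw [hb_def, mul_comm]
        exact htK
      · calc b ≤ r * ρ := Nat.mul_le_mul_left r hc.2.le
          _ ≤ K := by rw [mul_comm]; exact hrK
    by_contra! h2
    exact hnot ⟨h1, h2⟩
  obtain ⟨r', hr', hKr, hrK'⟩ := hb b hbpos (Dvd.intro c rfl) hbK
  obtain ⟨i, hi, hipos, hfat₂⟩ := exists_not_isNegligible_pow_mul hm hfat₁
    (C := insert (1 * ρ) (Set.Ico 1 ρ)) (h := g * r') (Nat.mul_pos hg hr')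
    (fun X hX h => card_le_of_sub_notMem hρ one_pos hX h) (hmany 1 one_pos)
  obtain ⟨x₂, hx₂, hx₂'⟩ := nonempty_of_not_isNegligible hm hfat₂
  refine hpow hx₂ ?_
  set y := r' * i with hy_def
  have hyK : y + b ≤ K := by
    have : i ≤ ρ := by
      rcases hi with rfl | hi
      · omega
      · exact hi.2.le
    calc y + b ≤ r' * ρ + b := Nat.add_le_add_right (Nat.mul_le_mul_left r' this) b
      _ ≤ K := by rw [mul_comm]; exact hKr
  have hKy : K - y ≤ g * y * (b * (1 + g)) := by
    have h1 : r' * (1 + g * (b * (1 + g))) ≤ y * (1 + g * (b * (1 + g))) :=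
      Nat.mul_le_mul_right _ (Nat.le_mul_of_pos_right r' hipos)
    have h2 : y * (1 + g * (b * (1 + g))) = y + g * y * (b * (1 + g)) := by ring
    omega
  -- The `g * y` factors from `P` and the last factor from `S` must make up `k = 1 + g * y + g * (K
  -- - y)`. Count `s` factors flexibly and the others once. If not all can be flexible, `s = ⌊(K -
  -- y) / b⌋` works, as `K - y` is less than twice `s * b` and `1 + g ≥ 2`.
  obtain ⟨s, hs1, hs2, hs3⟩ :
      ∃ s, s ≤ g * y ∧ s * b ≤ K - y ∧ K - y ≤ s * (b * (1 + g)) := by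
    by_cases hcase : g * y * b ≤ K - y
    · exact ⟨g * y, le_rfl, hcase, hKy⟩
    · refine ⟨(K - y) / b, ?_, Nat.div_mul_le_self _ _, ?_⟩
      · exact (Nat.div_le_of_le_mul (by rw [mul_comm]; omega))
      · have h1 := Nat.lt_div_mul_add hbpos (a := K - y)
        have h2 : b ≤ (K - y) / b * b :=
          Nat.le_mul_of_pos_left _ (Nat.div_pos (by omega) hbpos)
        rw [← mul_assoc]
        calc K - y ≤ (K - y) / b * b * (1 + 1) := by omega
          _ ≤ _ := by gcongr; exact hg
  have hfin := pow_subset_pow_of_subset Set.inter_subset_left hP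
    (Nat.le_mul_of_pos_right b (by omega)) (g * y) s (K - y) hs1 hs2 hs3
  rw [show k = (g * y + g * (K - y)) + 1 by
    rw [hk, ← mul_add, Nat.add_sub_cancel' (by omega), add_comm], pow_succ]
  rw [mul_assoc] at hx₂'
  exact Set.mul_subset_mul_right hfin hx₂'

end

/-! ### The numerical conditions on `k` -/

/-- Of `ρ - 3, ρ - 2, ρ - 1` only the outer two can share a factor, at most `2`, so their product
divides `2 * N`; this cubic bound suffices from `ρ = 12` on. For `8 ≤ ρ ≤ 11`, `N` is a multiple of
`3 · 4 · 5 · 7 = 420`. -/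
theorem three_mul_sq_le_of_forall_dvd {ρ N : ℕ} (hρ : 8 ≤ ρ) (hN : 0 < N)
    (h : ∀ l, 0 < l → l < ρ → l ∣ N) : 3 * ρ ^ 2 ≤ N := by
  by_cases h12 : ρ < 12
  · have h3 := h 3 (by omega) (by omega)
    have h4 := h 4 (by omega) (by omega)
    have h5 := h 5 (by omega) (by omega)
    have h7 := h 7 (by omega) (by omega)
    have : 420 ≤ N := by omega
    have : ρ ≤ 11 := by omega
    nlinarith
  · obtain ⟨a, rfl⟩ : ∃ a, ρ = a + 3 := ⟨ρ - 3, by omega⟩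
    have h0 := h a (by omega) (by omega)
    have h1 := h (a + 1) (by omega) (by omega)
    have h2 := h (a + 2) (by omega) (by omega)
    have hc : Nat.Coprime a (a + 1) := by simp
    have hc' : Nat.Coprime (a + 1) (a + 2) := by
      rw [show a + 2 = (a + 1) + 1 by ring]; simp
    have hd : a * (a + 1) * (a + 2) ∣ 2 * N := by
      have hA : a * (a + 2) ∣ 2 * N := by
        rw [← Nat.gcd_mul_lcm a (a + 2)]
        refine mul_dvd_mul ?_ (Nat.lcm_dvd h0 h2)
        rw [show a + 2 = 2 + a by ring, Nat.gcd_add_self_right]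
        exact Nat.gcd_dvd_right a 2
      have hB : Nat.Coprime (a * (a + 2)) (a + 1) := Nat.Coprime.mul_left hc hc'.symm
      have := hB.mul_dvd_of_dvd_of_dvd hA (h1.mul_left 2)
      rwa [mul_right_comm]
    have hle := Nat.le_of_dvd (by omega) hd
    have ha : 9 ≤ a := by omega
    nlinarith [mul_le_mul ha ha (by omega) (by omega), Nat.mul_le_mul_left (a * a) ha]

/-- The finitely many cases not covered by `div_bounds_of_le`, with `N = k - 1`. The omitted `N`
correspond to `k = 2` and to `k = 3, 5, 7, 13`; for each of them `ρ ≤ N / g` already fails at `g = ρ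
- 1`. -/
theorem div_bounds_of_lt : ∀ ρ ∈ List.range 8, ∀ N ∈ List.range (3 * ρ ^ 2),
    (∀ l ∈ List.range ρ, 0 < l → l ∣ N) ∧ ¬ ρ ∣ N ∧ N ∉ [1, 2, 4, 6, 12] →
    ∀ g ∈ List.range ρ, 0 < g → ρ ≤ N / g ∧
      ∀ b ∈ List.range (N / g), 0 < b ∧ N / g / ρ ∣ b ∧ b * (1 + g) < N / g →
        ρ * ((N / g + g * (b * (1 + g))) / (1 + g * (b * (1 + g)))) + b ≤ N / g := by
  decide +kernel

/-- Supplies the hypotheses of `isNegligible_inter_pow` with `r = ⌊K / ρ⌋` and `r' = ⌈K / (1 + B)⌉`,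
where `B = g * (b * (1 + g))`; the quotient in the statement is this ceiling. -/
theorem div_bounds_of_le {ρ N K g : ℕ} (hN : 3 * ρ ^ 2 ≤ N) (hK : N = g * K)
    (hg : 0 < g) (hgρ : g < ρ) : ρ ≤ K ∧ ∀ b, 0 < b → K / ρ ∣ b → b * (1 + g) < K →
      ρ * ((K + g * (b * (1 + g))) / (1 + g * (b * (1 + g)))) + b ≤ K := by
  have hρK : ρ ≤ K := by
    by_contra! h
    nlinarith [mul_le_mul hgρ.le h.le (by omega) (by omega)]
  refine ⟨hρK, fun b hb hrb hbK => ?_⟩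
  have hr := Nat.le_of_dvd hb hrb
  have hrK := Nat.lt_div_mul_add (show 0 < ρ by omega) (a := K)
  have h1 : K + 1 ≤ b * ρ + ρ := by
    have := Nat.mul_le_mul_right ρ hr
    omega
  set B := g * (b * (1 + g)) with hB
  -- `ρ * ((K + B) / (1 + B)) ≤ ρ * (K + B) / (1 + B) ≤ K - b`
  suffices h : ρ * (K + B) ≤ (K - b) * (1 + B) by
    have h2 : (1 + B) * (ρ * ((K + B) / (1 + B))) ≤ (1 + B) * (K - b) := by
      calc (1 + B) * (ρ * ((K + B) / (1 + B))) = ρ * ((1 + B) * ((K + B) / (1 + B))) := by ring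
        _ ≤ ρ * (K + B) := Nat.mul_le_mul_left ρ (Nat.mul_div_le _ _)
        _ ≤ _ := by rw [mul_comm]; linarith
    have h3 := Nat.le_of_mul_le_mul_left h2 (by omega)
    have h4 : b ≤ K := by nlinarith
    omega
  have hbK' : b ≤ K := by nlinarith
  obtain ⟨d, rfl⟩ := Nat.exists_eq_add_of_le hbK'
  rw [Nat.add_sub_cancel_left]
  have hρ0 : 0 < ρ := by omega
  rw [hK] at hN
  rw [hB]
  zify at hN h1 hbK hgρ hg hb hρ0 ⊢
  generalize (ρ : ℤ) = ρ at *
  generalize (g : ℤ) = g at *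
  generalize (b : ℤ) = b at *
  generalize (d : ℤ) = d at *
  -- Here `K = b + d`. The first bound uses `b(1 + g) < K` and `1 + g ≤ ρ`, the second `⌊K / ρ⌋ ≤
  -- b`, and both use `gK ≥ 3ρ²`. Their product, with `gK ≥ 3ρ²` once more, gives `ρ · gK ≤ (d -
  -- ρ)B`, which is more than needed.
  have hX : 2 * (g * (b + d)) ≤ 3 * ((1 + g) * (d - ρ)) := by nlinarith
  have hY : 2 * (g * (b + d)) ≤ 3 * (ρ * (g * b)) := by nlinarith
  have hN0 : 0 < g * (b + d) := by nlinarith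
  have hXY := mul_le_mul hX hY (by positivity) (by nlinarith)
  have hNN : 3 * ρ ^ 2 * (g * (b + d)) ≤ (g * (b + d)) * (g * (b + d)) :=
    mul_le_mul_of_nonneg_right hN hN0.le
  have hcancel : ρ * (ρ * (g * (b + d))) ≤ ρ * ((d - ρ) * (g * (b * (1 + g)))) := by nlinarith
  have h5 := le_of_mul_le_mul_left hcancel hρ0
  have h6 : ρ * (b + d) ≤ ρ * (g * (b + d)) := by
    have : 0 < b + d := pos_of_mul_pos_right hN0 hg.le
    nlinarith [mul_pos hρ0 this]
  have h7 : 0 < d := by nlinarith [mul_pos hb hg]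
  linarith

/-- If all positive integers less than `ρ` divide `k - 1` but `ρ` does not, then dense
`k`-product-free sets have few elements that are products of `ℓ ≤ ρ` elements. -/
theorem isNegligible_inter_pow_of_forall_dvd {A : Type*} [Fintype A] [Nonempty A]
    {m : Set (FreeMonoid A) → ℝ} {S : Set (FreeMonoid A)} (hm : IsWordMean m) {ρ k l : ℕ}
    (hk : 2 ≤ k) (hk' : k ∉ ({3, 5, 7, 13} : Set ℕ)) (hρ : 0 < ρ)
    (hdvd : ∀ l, 0 < l → l < ρ → l ∣ k - 1) (hndvd : ¬ ρ ∣ k - 1) (hS : IsProductFree k S)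
    (hd : 1 / (ρ : ℝ) ≤ supMean m S) (hl : 2 ≤ l) (hlρ : l ≤ ρ) :
    IsNegligible m S (S ∩ S ^ l) := by
  obtain ⟨g, rfl⟩ : ∃ g, l = 1 + g := ⟨l - 1, by omega⟩
  have hg : 0 < g := by omega
  have hgρ : g < ρ := by omega
  by_cases hk2 : k = 2
  · subst hk2
    have hρ2 : ρ ≤ 2 := by
      by_contra! h
      have := hdvd 2 (by omega) h
      omega
    obtain rfl : g = 1 := by omega
    have : S ∩ S ^ (1 + 1) = ∅ := (isProductFree_iff.1 hS).inter_eq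
    rw [this]
    exact isNegligible_empty hm
  · have hkne : k ≠ 3 ∧ k ≠ 5 ∧ k ≠ 7 ∧ k ≠ 13 := by simpa using hk'
    obtain ⟨K, hK⟩ := hdvd g hg hgρ
    have hkey : ρ ≤ K ∧ ∀ b, 0 < b → K / ρ ∣ b → b * (1 + g) < K →
        ρ * ((K + g * (b * (1 + g))) / (1 + g * (b * (1 + g)))) + b ≤ K := by
      by_cases hlarge : 3 * ρ ^ 2 ≤ k - 1
      · exact div_bounds_of_le hlarge hK hg hgρ
      · have h8 : ρ < 8 := by
          by_contra! h8
          exact hlarge (three_mul_sq_le_of_forall_dvd h8 (by omega) hdvd)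
        have hdiv : (k - 1) / g = K := by rw [hK, Nat.mul_div_cancel_left _ hg]
        have h := div_bounds_of_lt ρ (List.mem_range.2 h8) (k - 1)
          (List.mem_range.2 (by omega)) ⟨fun l hl hl0 => hdvd l hl0 (List.mem_range.1 hl), hndvd,
            by simp; omega⟩ g (List.mem_range.2 hgρ) hg
        rw [hdiv] at h
        refine ⟨h.1, fun b hb0 hb hbK => h.2 b (List.mem_range.2 ?_) ⟨hb0, hb, hbK⟩⟩
        nlinarith
    refine isNegligible_inter_pow hm hρ hg (K := K) (r := K / ρ) (by omega) hS hd
      (Nat.div_pos hkey.1 hρ) (Nat.mul_div_le _ _) fun b hb0 hb hbK => ?_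
    refine ⟨_, Nat.div_pos (by omega) (by omega), hkey.2 b hb0 hb hbK, ?_⟩
    set B := g * (b * (1 + g))
    have h1 := Nat.lt_div_mul_add (show 0 < 1 + B by omega) (a := K + B)
    omega

/-! ### Structure of uniformly extremal sets -/

/-- Up to a set of mean zero, the left quotients of `R` by `u` and `v` agree. -/
def SameQuotient {A : Type*} (m : Set (FreeMonoid A) → ℝ) (R : Set (FreeMonoid A))
    (u v : FreeMonoid A) : Prop :=
  m (leftQuotient R u \ leftQuotient R v) = 0

/-- Suffixes of a factorisation differ by a product of `j - i` elements of `S`, which is what makes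
their left quotients disjoint in the extremal case. -/
theorem exists_suffixes_of_mem_pow {M : Type*} [Monoid M] {S : Set M} {n : ℕ} {p : M}
    (hp : p ∈ S ^ n) :
    ∃ t : ℕ → M, t 0 = 1 ∧ t n = p ∧ ∀ i j, i ≤ j → j ≤ n → ∃ q ∈ S ^ (j - i), t j = q * t i := by
  induction n generalizing p with
  | zero =>
    rw [pow_zero, Set.mem_one] at hp
    refine ⟨fun _ => 1, rfl, hp.symm, fun i j _ _ => ⟨1, ?_, by simp⟩⟩
    rw [show j - i = 0 by omega, pow_zero]
    exact Set.one_mem_one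
  | succ n ih =>
    rw [pow_succ'] at hp
    obtain ⟨s, hs, e, he, rfl⟩ := Set.mem_mul.1 hp
    obtain ⟨t, h0, hn, ht⟩ := ih he
    refine ⟨fun i => if i ≤ n then t i else s * e, by simpa using h0, by simp, ?_⟩
    intro i j hij hj
    by_cases hjn : j ≤ n
    · simpa only [hjn, hij.trans hjn, if_true] using ht i j hij hjn
    · obtain rfl : j = n + 1 := by omega
      by_cases hi : i ≤ n
      · obtain ⟨q, hq, hqt⟩ := ht i n hi le_rfl
        refine ⟨s * q, ?_, by simp only [hi, hjn, if_true, if_false, ← hn, hqt, mul_assoc]⟩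
        rw [show n + 1 - i = (n - i) + 1 by omega, pow_succ']
        exact Set.mul_mem_mul hs hq
      · refine ⟨1, ?_, by simp only [hi, hjn, if_false, one_mul]⟩
        rw [show n + 1 - i = 0 by omega, pow_zero]
        exact Set.one_mem_one

/-- `R` is strongly `n`-product-free, and its density in every cone is the largest possible. -/
structure IsUniformlyExtremal {A : Type*} (m : Set (FreeMonoid A) → ℝ) (n : ℕ) (R : Set (FreeMonoid A)) :
    Prop where
  two_le : 2 ≤ n
  free : IsStronglyProductFree n R
  eq_inv : ∀ u, m (leftQuotient R u) = 1 / n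

/-- If `v * x` and `q * (v * x)` were both in `R`, the latter would be a product of `i + 1 ≤ n`
elements of `R`. -/
theorem IsUniformlyExtremal.disjoint_leftQuotient_mul {A : Type*}
    {m : Set (FreeMonoid A) → ℝ} {R : Set (FreeMonoid A)} {n : ℕ} (hR : IsUniformlyExtremal m n R) {i : ℕ} (hi : 0 < i)
    (hin : i < n) {q : FreeMonoid A} (hq : q ∈ R ^ i) (v : FreeMonoid A) :
    Disjoint (leftQuotient R v) (leftQuotient R (q * v)) := by
  rw [Set.disjoint_left]
  intro x hx hx'
  refine Set.disjoint_left.1 (isProductFree_iff.1 (hR.free (i + 1) (by omega) hin)) hx' ?_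
  rw [pow_succ, mul_assoc]
  exact Set.mul_mem_mul hq hx

theorem IsUniformlyExtremal.not_sameQuotient_of_disjoint {A : Type*}
    {m : Set (FreeMonoid A) → ℝ} {R : Set (FreeMonoid A)} {n : ℕ} (hR : IsUniformlyExtremal m n R) {u v : FreeMonoid A}
    (h : Disjoint (leftQuotient R u) (leftQuotient R v)) : ¬ SameQuotient m R u v := by
  rw [SameQuotient, h.sdiff_eq_left, hR.eq_inv]
  have : 0 < n := by have := hR.two_le; omega
  positivity

section

variable {A : Type*} [Fintype A] {m : Set (FreeMonoid A) → ℝ}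
  {R : Set (FreeMonoid A)} {n : ℕ}

theorem SameQuotient.trans (hm : IsWordMean m) {u v w : FreeMonoid A}
    (h₁ : SameQuotient m R u v) (h₂ : SameQuotient m R v w) : SameQuotient m R u w := by
  refine le_antisymm ?_ (hm.nonneg _)
  refine (hm.mono (C := (leftQuotient R u \ leftQuotient R v) ∪
    (leftQuotient R v \ leftQuotient R w)) ?_).trans ((hm.union_le _ _).trans ?_)
  · rintro x ⟨h1, h2⟩
    by_cases h : x ∈ leftQuotient R v
    · exact Or.inr ⟨h, h2⟩
    · exact Or.inl ⟨h1, h⟩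
  · rw [show m _ = 0 from h₁, show m _ = 0 from h₂, add_zero]

theorem SameQuotient.refl (hm : IsWordMean m) (u : FreeMonoid A) : SameQuotient m R u u := by
  rw [SameQuotient, sdiff_self]
  exact hm.empty

theorem SameQuotient.mul_right [Nonempty A] (hm : IsWordMean m) {u v : FreeMonoid A}
    (h : SameQuotient m R u v) (z : FreeMonoid A) : SameQuotient m R (u * z) (v * z) := by
  have h' := hm.leftQuotient_eq_zero h z
  rw [SameQuotient, ← leftQuotient_leftQuotient, ← leftQuotient_leftQuotient R v]
  exact h'

namespace IsUniformlyExtremal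

/-- Both quotients have mean `1 / n`, so if one difference is null, so is the other. -/
theorem symm (hR : IsUniformlyExtremal m n R) (hm : IsWordMean m) {u v : FreeMonoid A}
    (h : SameQuotient m R u v) : SameQuotient m R v u := by
  have h1 := hm.inter_add_diff (leftQuotient R u) (leftQuotient R v)
  have h2 := hm.inter_add_diff (leftQuotient R v) (leftQuotient R u)
  rw [hR.eq_inv] at h1 h2
  rw [show m _ = 0 from h, Set.inter_comm] at h1
  rw [SameQuotient]
  linarith

theorem sum_eq_one (hR : IsUniformlyExtremal m n R) (hm : IsWordMean m) (t : ℕ → FreeMonoid A)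
    (ht : ∀ i j, i < j → j < n → Disjoint (leftQuotient R (t i)) (leftQuotient R (t j))) :
    m (⋃ i ∈ Finset.range n, leftQuotient R (t i)) = 1 := by
  rw [hm.biUnion_eq]
  · have : (n : ℝ) ≠ 0 := by have := hR.two_le; exact_mod_cast (by omega : n ≠ 0)
    simp [hR.eq_inv, this]
  · intro i hi j hj hij
    rw [Finset.mem_coe, Finset.mem_range] at hi hj
    rcases lt_or_gt_of_ne hij with h | h
    · exact ht i j h hj
    · exact (ht j i h hi).symm

/-- If `u` avoids all but one part of a partition into left quotients, then its left quotient is the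
remaining part. -/
theorem sameQuotient_of_disjoint (hR : IsUniformlyExtremal m n R) (hm : IsWordMean m)
    (t : ℕ → FreeMonoid A)
    (ht : ∀ i j, i < j → j < n → Disjoint (leftQuotient R (t i)) (leftQuotient R (t j)))
    {u : FreeMonoid A} {i : ℕ}
    (hu : ∀ j < n, j ≠ i → Disjoint (leftQuotient R u) (leftQuotient R (t j))) :
    SameQuotient m R u (t i) := by
  have h := hR.sum_eq_one hm t ht
  refine le_antisymm ?_ (hm.nonneg _)
  have hc : m (⋃ i ∈ Finset.range n, leftQuotient R (t i))ᶜ = 0 := by rw [hm.compl, h, sub_self]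
  rw [← hc]
  refine hm.mono ?_
  rintro x ⟨hx1, hx2⟩ hx3
  obtain ⟨j, hj, hxj⟩ := Set.mem_iUnion₂.1 hx3
  by_cases hji : j = i
  · exact hx2 (hji ▸ hxj)
  · exact Set.disjoint_left.1 (hu j (Finset.mem_range.1 hj) hji) hx1 hxj

/-- The proper suffixes `t 0 = 1, …, t (n - 1)` of `p` give `n` disjoint quotients of mean `1 / n`,
hence a partition up to a null set. The quotient by `p` avoids all of them except the one from `t
0`. -/
theorem sameQuotient_pow_mul (hR : IsUniformlyExtremal m n R) (hm : IsWordMean m)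
    {p : FreeMonoid A} (hp : p ∈ R ^ n) (v : FreeMonoid A) : SameQuotient m R (p * v) v := by
  obtain ⟨t, h0, hn, ht⟩ := exists_suffixes_of_mem_pow hp
  have hn2 := hR.two_le
  have hdisj : ∀ i j, i < j → j ≤ n → j - i < n →
      Disjoint (leftQuotient R (t i * v)) (leftQuotient R (t j * v)) := by
    intro i j hij hj hjn
    obtain ⟨q, hq, hqt⟩ := ht i j hij.le hj
    rw [hqt, mul_assoc]
    exact hR.disjoint_leftQuotient_mul (by omega) hjn hq _
  have h := hR.sameQuotient_of_disjoint hm (fun i => t i * v)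
    (fun i j hij hj => hdisj i j hij hj.le (by omega)) (u := p * v) (i := 0) fun j hj hj0 => by
      rw [← hn]
      exact (hdisj j n hj le_rfl (by omega)).symm
  simpa only [h0, one_mul] using h

theorem nonempty (hR : IsUniformlyExtremal m n R) (hm : IsWordMean m) : R.Nonempty := by
  rw [Set.nonempty_iff_ne_empty]
  rintro rfl
  have h := hR.eq_inv 1
  rw [leftQuotient_one, hm.empty] at h
  have : 0 < n := by have := hR.two_le; omega
  have : (0 : ℝ) < 1 / n := by positivity
  linarith

/-- Products of `i` elements of `R` all act alike. For `i ≥ n` a prefix from `R ^ n` acts trivially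
and can be dropped. For `i < n` the quotient by `q` is disjoint from those by `s ^ j` with `j ≠ i`,
`j < n`, so it is the remaining part of the partition. -/
theorem sameQuotient_pow_mul_pow_mul [Nonempty A] (hR : IsUniformlyExtremal m n R) (hm : IsWordMean m) (i : ℕ) :
    ∀ {q q' : FreeMonoid A}, q ∈ R ^ i → q' ∈ R ^ i → ∀ z, SameQuotient m R (q * z) (q' * z) := by
  obtain ⟨s, hs⟩ := hR.nonempty hm
  have hn := hR.two_le
  induction i using Nat.strong_induction_on with
  | _ i ih =>
  intro q q' hq hq' z
  by_cases hin : n ≤ i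
  · obtain ⟨j, rfl⟩ := Nat.exists_eq_add_of_le hin
    rw [pow_add] at hq hq'
    obtain ⟨w, hw, e, he, rfl⟩ := Set.mem_mul.1 hq
    obtain ⟨w', hw', e', he', rfl⟩ := Set.mem_mul.1 hq'
    have h1 := hR.sameQuotient_pow_mul hm hw (e * z)
    have h2 := hR.sameQuotient_pow_mul hm hw' (e' * z)
    rw [mul_assoc, mul_assoc]
    exact (h1.trans hm (ih j (by omega) he he' z)).trans hm (hR.symm hm h2)
  · -- products of different numbers of elements of `R` have disjoint left quotients
    have hdisj : ∀ l ≤ i, ∀ j, l < j → j < n → ∀ q ∈ R ^ l, ∀ q' ∈ R ^ j,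
        Disjoint (leftQuotient R q) (leftQuotient R q') := by
      intro l hl j hlj hj q hq q' hq'
      rcases Nat.eq_zero_or_pos l with rfl | hl0
      · rw [pow_zero, Set.mem_one] at hq
        subst hq
        simpa using hR.disjoint_leftQuotient_mul hlj hj hq' 1
      · rw [Set.disjoint_left]
        intro z hz hz'
        -- Split `q = a * e` and `q' = a' * e'` with `e, e' ∈ R ^ (l - 1)`, and suppose `a * e * z`
        -- and `a' * e' * z` are in `R`. Filling up to `n` factors shows that `e * z` acts like `1`.
        -- It also shows that `e' * z` acts like a product of `n - d + 1` elements, where `d = j - l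
        -- + 1 ≥ 2`, whose quotient is disjoint from `R`. But `e * z` and `e' * z` act alike by
        -- induction.
        have hl1 : R ^ l = R * R ^ (l - 1) := by
          rw [← pow_succ', Nat.sub_add_cancel hl0]
        have hj1 : R ^ j = R ^ (j - (l - 1)) * R ^ (l - 1) := by
          rw [← pow_add]; congr 1; omega
        rw [hl1] at hq
        rw [hj1] at hq'
        obtain ⟨a, ha, e, he, rfl⟩ := Set.mem_mul.1 hq
        obtain ⟨a', ha', e', he', rfl⟩ := Set.mem_mul.1 hq'
        have h1 := ih (l - 1) (by omega) he he' z
        have hp1 : s ^ (n - 1) * a ∈ R ^ n := by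
          rw [show n = (n - 1) + 1 by omega, pow_succ R]
          exact Set.mul_mem_mul (Set.pow_mem_pow hs) ha
        have h2 := hR.sameQuotient_pow_mul hm hp1 (e * z)
        have hp2 : s ^ (n - 1) * (a * e * z) ∈ R ^ n := by
          rw [show n = (n - 1) + 1 by omega, pow_succ R]
          exact Set.mul_mem_mul (Set.pow_mem_pow hs) hz
        have h3 := hR.sameQuotient_pow_mul hm hp2 1
        have hp3 : s ^ (n - (j - (l - 1))) * a' ∈ R ^ n := by
          rw [show n = (n - (j - (l - 1))) + (j - (l - 1)) by omega, pow_add R,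
            Nat.add_sub_cancel]
          exact Set.mul_mem_mul (Set.pow_mem_pow hs) ha'
        have h4 := hR.sameQuotient_pow_mul hm hp3 (e' * z)
        have hp4 : s ^ (n - (j - (l - 1))) * (a' * e' * z) ∈ R ^ (n - (j - (l - 1)) + 1) := by
          rw [pow_succ R]
          exact Set.mul_mem_mul (Set.pow_mem_pow hs) hz'
        have h5 := hR.disjoint_leftQuotient_mul (by omega) (by omega) hp4 1
        refine hR.not_sameQuotient_of_disjoint h5 ?_
        rw [mul_one] at h3 ⊢
        have h2' : SameQuotient m R (s ^ (n - 1) * (a * e * z)) (e * z) := by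
          simpa only [mul_assoc] using h2
        have h4' : SameQuotient m R (s ^ (n - (j - (l - 1))) * (a' * e' * z)) (e' * z) := by
          simpa only [mul_assoc] using h4
        exact (((hR.symm hm h3).trans hm h2').trans hm h1).trans hm (hR.symm hm h4')
    have hpart : ∀ j l, j < l → l < n →
        Disjoint (leftQuotient R (s ^ j)) (leftQuotient R (s ^ l)) := by
      intro j l hjl hl
      have h := hR.disjoint_leftQuotient_mul (by omega) (by omega)
        (Set.pow_mem_pow hs : s ^ (l - j) ∈ R ^ (l - j)) (s ^ j)
      rwa [← pow_add, Nat.sub_add_cancel hjl.le] at h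
    have key : ∀ q ∈ R ^ i, SameQuotient m R q (s ^ i) := by
      intro q hq
      refine hR.sameQuotient_of_disjoint hm (fun j => s ^ j) hpart fun j hj hji => ?_
      rcases lt_or_gt_of_ne hji with h | h
      · exact (hdisj j h.le i h (by omega) _ (Set.pow_mem_pow hs) q hq).symm
      · exact hdisj i le_rfl j h hj q hq _ (Set.pow_mem_pow hs)
    exact ((key q hq).trans hm (hR.symm hm (key q' hq'))).mul_right hm z

theorem sameQuotient_pow_of_modEq (hR : IsUniformlyExtremal m n R) (hm : IsWordMean m)
    {s : FreeMonoid A} (hs : s ∈ R) {i j : ℕ} (h : i ≡ j [MOD n]) (v : FreeMonoid A) :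
    SameQuotient m R (s ^ i * v) (s ^ j * v) := by
  have hadd (i l : ℕ) : SameQuotient m R (s ^ (i + n * l) * v) (s ^ i * v) := by
    induction l with
    | zero => exact SameQuotient.refl hm _
    | succ l ih =>
      refine SameQuotient.trans hm ?_ ih
      have := hR.sameQuotient_pow_mul hm (Set.pow_mem_pow hs : s ^ n ∈ R ^ n)
        (s ^ (i + n * l) * v)
      rwa [← mul_assoc, ← pow_add, show n + (i + n * l) = i + n * (l + 1) by ring] at this
  have key (i j : ℕ) (hij : i ≤ j) (h : i ≡ j [MOD n]) :
      SameQuotient m R (s ^ j * v) (s ^ i * v) := by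
    obtain ⟨l, hl⟩ := (Nat.modEq_iff_dvd' hij).1 h
    obtain rfl : j = i + n * l := by omega
    exact hadd i l
  rcases le_total i j with hij | hij
  · exact hR.symm hm (key i j hij h)
  · exact key j i hij h.symm

theorem modEq_of_sameQuotient (hR : IsUniformlyExtremal m n R) (hm : IsWordMean m)
    {s : FreeMonoid A} (hs : s ∈ R) {i j : ℕ} (h : SameQuotient m R (s ^ i) (s ^ j)) :
    i ≡ j [MOD n] := by
  have hn : 0 < n := by have := hR.two_le; omega
  have h1 := hR.sameQuotient_pow_of_modEq hm hs (Nat.mod_modEq i n) 1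
  have h2 := hR.sameQuotient_pow_of_modEq hm hs (Nat.mod_modEq j n) 1
  simp only [mul_one] at h1 h2
  have h3 := (h1.trans hm h).trans hm (hR.symm hm h2)
  have key (i j : ℕ) (hij : i < j) (hj : j < n) : ¬ SameQuotient m R (s ^ i) (s ^ j) := by
    have h := hR.disjoint_leftQuotient_mul (by omega) (by omega)
      (Set.pow_mem_pow hs : s ^ (j - i) ∈ R ^ (j - i)) (s ^ i)
    rw [← pow_add, Nat.sub_add_cancel hij.le] at h
    exact hR.not_sameQuotient_of_disjoint h
  rcases lt_trichotomy (i % n) (j % n) with hlt | heq | hlt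
  · exact absurd h3 (key _ _ hlt (Nat.mod_lt _ hn))
  · exact heq
  · exact absurd (hR.symm hm h3) (key _ _ hlt (Nat.mod_lt _ hn))

/-- The quotients by `s ^ i`, `i < n`, cover almost all words, and removing a last letter keeps null
sets null. So some `x ∈ R` and `i < n` have `s ^ i * x * a ∈ R`. This word acts like `s`, while `s ^
i * x` acts like `s ^ (i + 1)`, so `a` acts like `s ^ (n - i)`. -/
theorem exists_letter_label [Nonempty A] (hR : IsUniformlyExtremal m n R) (hm : IsWordMean m)
    {s : FreeMonoid A} (hs : s ∈ R) (a : A) :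
    ∃ c : ℕ, ∀ j, SameQuotient m R (s ^ j * FreeMonoid.of a) (s ^ (j + c)) := by
  have hn := hR.two_le
  set G := ⋃ i ∈ Finset.range n, leftQuotient R (s ^ i) with hG
  have hG1 : m Gᶜ = 0 := by
    rw [hm.compl, hR.sum_eq_one hm, sub_self]
    intro j l hjl hl
    have h := hR.disjoint_leftQuotient_mul (by omega) (by omega)
      (Set.pow_mem_pow hs : s ^ (l - j) ∈ R ^ (l - j)) (s ^ j)
    rwa [← pow_add, Nat.sub_add_cancel hjl.le] at h
  have hG2 : m {w | w * FreeMonoid.of a ∈ Gᶜ} = 0 := by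
    refine le_antisymm ?_ (hm.nonneg _)
    simpa [hG1] using hm.right_le Gᶜ a
  obtain ⟨x, hx, hxG⟩ : ∃ x ∈ R, x * FreeMonoid.of a ∈ G := by
    by_contra! hcon
    have h1 := hm.mono (show R ⊆ {w | w * FreeMonoid.of a ∈ Gᶜ} from hcon)
    have h2 := hR.eq_inv 1
    rw [leftQuotient_one] at h2
    have : 0 < n := by omega
    have : (0 : ℝ) < 1 / n := by positivity
    linarith
  obtain ⟨i, hi, hxi⟩ := Set.mem_iUnion₂.1 hxG
  rw [Finset.mem_range] at hi
  rw [mem_leftQuotient] at hxi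
  refine ⟨n - i, fun j => ?_⟩
  -- insert `s ^ n` in front, replace one factor by `x`, insert `s ^ n`, and use `s ^ i * x * a ∈ R`
  have h1 := hR.sameQuotient_pow_of_modEq hm hs
    (show j ≡ (j + n - 1) + 1 [MOD n] by
      rw [Nat.sub_add_cancel (by omega)]; exact (Nat.add_mod_right j n).symm) (FreeMonoid.of a)
  have h2 := hR.sameQuotient_pow_mul_pow_mul hm (j + n - 1 + 1)
    (Set.pow_mem_pow hs : s ^ (j + n - 1 + 1) ∈ R ^ (j + n - 1 + 1))
    (show s ^ (j + n - 1) * x ∈ R ^ (j + n - 1 + 1) by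
      rw [pow_succ R]; exact Set.mul_mem_mul (Set.pow_mem_pow hs) hx) (FreeMonoid.of a)
  have h3 := hR.sameQuotient_pow_mul_pow_mul hm (j + n - 1 - i + 1)
    (show s ^ (j + n - 1 - i) * (s ^ i * (x * FreeMonoid.of a)) ∈ R ^ (j + n - 1 - i + 1) by
      rw [pow_succ R]; exact Set.mul_mem_mul (Set.pow_mem_pow hs) hxi)
    (Set.pow_mem_pow hs : s ^ (j + n - 1 - i + 1) ∈ R ^ (j + n - 1 - i + 1)) 1
  rw [mul_one, mul_one, ← mul_assoc, ← pow_add, Nat.sub_add_cancel (by omega),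
    show j + n - 1 - i + 1 = j + (n - i) by omega, ← mul_assoc] at h3
  exact (h1.trans hm h2).trans hm h3

/-- Letters can be labelled such that the sum of the labels of a word determines the left quotient
by this word. -/
theorem exists_label [Nonempty A] (hR : IsUniformlyExtremal m n R) (hm : IsWordMean m) :
    ∃ label : A → ZMod n, R ⊆ labelSumOne label ∧ ∀ w : FreeMonoid A,
      (w.toList.map label).sum = 0 → m (R \ leftQuotient R w) = 0 := by
  have hn := hR.two_le
  have : NeZero n := ⟨by omega⟩
  obtain ⟨s, hs⟩ := hR.nonempty hm
  choose c hc using hR.exists_letter_label hm hs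
  have key (w : FreeMonoid A) : ∀ j : ℕ, SameQuotient m R (s ^ j * w)
      (s ^ (j + (w.toList.map c).sum)) := by
    induction w using FreeMonoid.inductionOn' with
    | one => simpa using fun j => SameQuotient.refl hm _
    | of_mul a w ih =>
      intro j
      have h1 := (hc a j).mul_right hm w
      have h2 := h1.trans hm (ih (j + c a))
      simpa [mul_assoc, add_assoc] using h2
  have hcast (w : FreeMonoid A) : (w.toList.map fun a => (c a : ZMod n)).sum =
      ((w.toList.map c).sum : ℕ) := by
    rw [Nat.cast_list_sum, List.map_map]; rfl
  refine ⟨fun a => c a, fun r hr => ?_, fun w hw => ?_⟩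
  · have h1 := key r 0
    have h2 := hR.sameQuotient_pow_mul_pow_mul hm 1 (q := s) (q' := r) (by simpa using hs)
      (by simpa using hr) 1
    rw [pow_zero, one_mul, zero_add] at h1
    rw [mul_one, mul_one] at h2
    have h3 := hR.modEq_of_sameQuotient hm hs (i := 1) (by simpa using h2.trans hm h1)
    change (r.toList.map fun a => (c a : ZMod n)).sum = 1
    rw [hcast, ← (ZMod.natCast_eq_natCast_iff _ _ _).2 h3, Nat.cast_one]
  · rw [hcast, ← Nat.cast_zero, ZMod.natCast_eq_natCast_iff] at hw
    have h1 := hR.symm hm (key w 0)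
    have h2 := hR.sameQuotient_pow_of_modEq hm hs hw.symm 1
    rw [pow_zero, one_mul] at h2
    rw [pow_zero, one_mul, zero_add] at h1
    rw [mul_one] at h2
    have h3 := h2.trans hm h1
    rwa [SameQuotient, leftQuotient_one] at h3

end IsUniformlyExtremal

end

/-! ### Label sums, the alphabet without letters, and congruences modulo `ρ` -/

theorem sum_map_toList_mul {A : Type*} {r : ℕ} (label : A → ZMod r) (u v : FreeMonoid A) :
    ((u * v).toList.map label).sum = (u.toList.map label).sum + (v.toList.map label).sum := by
  simp

theorem sum_map_toList_pow {A : Type*} {r : ℕ} (label : A → ZMod r) (u : FreeMonoid A) (n : ℕ) :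
    ((u ^ n).toList.map label).sum = n * (u.toList.map label).sum := by
  induction n with
  | zero => simp
  | succ n ih =>
    rw [pow_succ, sum_map_toList_mul, ih]
    push_cast
    ring

theorem isProductFree_labelSumOne {A : Type*} {r l : ℕ} (label : A → ZMod r)
    (h : (l : ZMod r) ≠ 1) : IsProductFree l (labelSumOne label) := by
  have key (n : ℕ) : ∀ w ∈ labelSumOne label ^ n, (w.toList.map label).sum = n := by
    induction n with
    | zero =>
      intro w hw
      rw [pow_zero, Set.mem_one] at hw
      simp [hw]
    | succ n ih =>
      intro w hw
      rw [pow_succ] at hw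
      obtain ⟨u, hu, v, hv, rfl⟩ := Set.mem_mul.1 hw
      have hv : (v.toList.map label).sum = 1 := hv
      rw [sum_map_toList_mul, ih u hu, hv]
      push_cast
      rfl
  rw [isProductFree_iff, Set.disjoint_left]
  intro w hw hw'
  have hw : (w.toList.map label).sum = 1 := hw
  exact h ((key l w hw').symm.trans hw)

theorem upperBanachDensity_of_isEmpty {A : Type*} [Fintype A] [IsEmpty A]
    (S : Set (FreeMonoid A)) : upperBanachDensity S = 0 := by
  have h : (fun p : ℕ × ℕ => intervalDensity S p.1 p.2) =ᶠ[atTop ×ˢ atTop] fun _ => 0 := by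
    filter_upwards [tendsto_fst.eventually_ge_atTop 1] with p hp
    rw [intervalDensity, Finset.sum_eq_zero, zero_div]
    intro n hn
    have : n ≠ 0 := by have := (Finset.mem_Ico.1 hn).1; omega
    simp [layerDensity, this]
  rw [upperBanachDensity, limsup_congr h, limsup_const]

theorem rho_spec {k : ℕ} (hk : 2 ≤ k) :
    2 ≤ rho k ∧ ¬ rho k ∣ k - 1 ∧ ∀ l, 0 < l → l < rho k → l ∣ k - 1 := by
  have hmem : rho k ∈ {l : ℕ | 0 < l ∧ ¬ l ∣ k - 1} :=
    Nat.sInf_mem ⟨k, by omega, fun h => by have := Nat.le_of_dvd (by omega) h; omega⟩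
  refine ⟨?_, hmem.2, fun l hl hlt => ?_⟩
  · by_contra! h
    have h1 : rho k = 1 := by have := hmem.1; omega
    exact hmem.2 (by rw [h1]; exact one_dvd _)
  · by_contra hnd
    exact Nat.notMem_of_lt_sInf hlt ⟨hl, hnd⟩

/-- A linear congruence modulo `ρ` is solvable if the greatest common divisor of the coefficient
and `ρ` divides the right hand side. -/
theorem exists_natCast_mul_add_eq_zero {ρ N : ℕ} (h : ∀ l, 0 < l → l < ρ → l ∣ N) (hρ : 0 < ρ)
    {e : ZMod ρ} (he : e ≠ 0) : ∃ i < ρ, (i : ZMod ρ) * e + N = 0 := by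
  have : NeZero ρ := ⟨hρ.ne'⟩
  have hpos : 0 < e.val := Nat.pos_of_ne_zero ((ZMod.val_ne_zero e).2 he)
  obtain ⟨w, hw⟩ := h (Nat.gcd e.val ρ) (Nat.gcd_pos_of_pos_left _ hpos)
    ((Nat.gcd_le_left _ hpos).trans_lt e.val_lt)
  have hbez : ((Nat.gcd e.val ρ : ℕ) : ZMod ρ) = e * (Nat.gcdA e.val ρ : ZMod ρ) := by
    have := congrArg (Int.cast : ℤ → ZMod ρ) (Nat.gcd_eq_gcd_ab e.val ρ)
    push_cast at this
    simpa using this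
  refine ⟨(-((Nat.gcdA e.val ρ : ZMod ρ) * w)).val, ZMod.val_lt _, ?_⟩
  rw [ZMod.natCast_val, ZMod.cast_id, hw, Nat.cast_mul, hbez]
  ring

/-! ### From the extremal subset back to `S` -/

section

variable {A : Type*} [Fintype A] [Nonempty A] {m : Set (FreeMonoid A) → ℝ}
  {S N : Set (FreeMonoid A)} {ρ : ℕ}

/-- In a cone where `S` nearly attains `supMean m S`, the set `N` has small mean, so the bound for
`S \ N` passes to `S`. -/
theorem supMean_le_of_isNegligible (hm : IsWordMean m) (hN : IsNegligible m S N) (hρ : 0 < ρ)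
    (hS : IsStronglyProductFree ρ (S \ N)) : supMean m S ≤ 1 / ρ := by
  by_contra! hlt
  obtain ⟨η, hη, H⟩ := hN ((supMean m S - 1 / ρ) / 2) (by linarith)
  obtain ⟨u, hu⟩ := exists_supMean_sub_lt m S
    (lt_min hη (show 0 < (supMean m S - 1 / ρ) / 2 by linarith))
  have h1 := H u (by linarith [min_le_left η ((supMean m S - 1 / ρ) / 2)])
  have h2 := hm.inter_add_diff (leftQuotient S u) (leftQuotient N u)
  have h3 := hm.mono (Set.inter_subset_right : leftQuotient S u ∩ leftQuotient N u ⊆ _)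
  have h4 : m (leftQuotient S u \ leftQuotient N u) ≤ 1 / ρ :=
    (le_supMean hm (S \ N) u).trans (supMean_le_of_isStronglyProductFree hm hρ hS)
  linarith [min_le_right η ((supMean m S - 1 / ρ) / 2)]

/-- An average with positive weights that equals an upper bound of its terms is attained by every
term. -/
theorem eq_supMean_of_supMean_le (hm : IsWordMean m) (h : supMean m S ≤ m S)
    (u : FreeMonoid A) : m (leftQuotient S u) = m S := by
  have hle (v : FreeMonoid A) : m (leftQuotient S v) ≤ m S := (le_supMean hm S v).trans h
  have hq : (0 : ℝ) < (Fintype.card A : ℝ) ^ u.length :=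
    pow_pos (by exact_mod_cast Fintype.card_pos) _
  have h1 := le_wordAvg (f := fun v => m S - m (leftQuotient S v))
    (fun v => sub_nonneg.2 (hle v)) u
  rw [wordAvg_sub, wordAvg_const, ← hm.eq_wordAvg, sub_self, div_le_iff₀ hq, zero_mul] at h1
  linarith [hle u]

/-- The supremum is attained at the empty word, where negligible means of mean zero. Hence `N` is
null in every cone, and `S \ N` has the same cone means as `S`. -/
theorem isUniformlyExtremal_diff (hm : IsWordMean m) (hN : IsNegligible m S N) (hρ : 2 ≤ ρ)
    (hS : IsStronglyProductFree ρ (S \ N)) (hd : m S = 1 / ρ) :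
    IsUniformlyExtremal m ρ (S \ N) := by
  have hsup : supMean m S ≤ m S :=
    hd ▸ supMean_le_of_isNegligible hm hN (by omega) hS
  have hN0 : m N = 0 := by
    refine le_antisymm (le_of_forall_pos_lt_add fun c hc => ?_) (hm.nonneg _)
    obtain ⟨η, hη, H⟩ := hN c hc
    have h := H 1 (by rw [leftQuotient_one]; linarith)
    rwa [leftQuotient_one, ← zero_add c] at h
  refine ⟨hρ, hS, fun u => ?_⟩
  have h1 := hm.inter_add_diff (leftQuotient S u) (leftQuotient N u)
  have h2 := hm.mono (Set.inter_subset_right : leftQuotient S u ∩ leftQuotient N u ⊆ _)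
  rw [hm.leftQuotient_eq_zero hN0] at h2
  have h3 := hm.nonneg (leftQuotient S u ∩ leftQuotient N u)
  rw [eq_supMean_of_supMean_le hm hsup, hd] at h1
  have h4 : leftQuotient (S \ N) u = leftQuotient S u \ leftQuotient N u := rfl
  rw [h4]
  linarith

theorem isNegligible_biUnion_inter_pow (hm : IsWordMean m) {k : ℕ} (hk : 2 ≤ k)
    (hk' : k ∉ ({3, 5, 7, 13} : Set ℕ)) (hS : IsProductFree k S)
    (hd : 1 / (rho k : ℝ) ≤ supMean m S) :
    IsNegligible m S (⋃ l ∈ Finset.Icc 2 (rho k), S ∩ S ^ l) := by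
  obtain ⟨hρ, hndvd, hdvd⟩ := rho_spec hk
  refine isNegligible_biUnion hm _ fun l hl => ?_
  rw [Finset.mem_Icc] at hl
  exact isNegligible_inter_pow_of_forall_dvd hm hk hk' (by omega) hdvd hndvd hS hd hl.1 hl.2

/-- The labels come from `R = S \ N`. To see that they also fit a removed element `r`, powers of `r`
and `s ∈ R` are combined into a product of `k - 1` elements of `S` with label sum `0`. Its quotient
agrees with `R` up to a null set, so it maps some `x ∈ R` into `R`, against `k`-product-freeness of
`S`. -/
theorem exists_label_of_isWordMean (hm : IsWordMean m) {k : ℕ} (hk : 2 ≤ k)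
    (hk' : k ∉ ({3, 5, 7, 13} : Set ℕ)) (hS : IsProductFree k S)
    (hd : m S = 1 / (rho k : ℝ)) : ∃ label : A → ZMod (rho k), S ⊆ labelSumOne label := by
  obtain ⟨hρ, hndvd, hdvd⟩ := rho_spec hk
  have hsup : 1 / (rho k : ℝ) ≤ supMean m S := by
    have h := le_supMean hm S 1
    rwa [leftQuotient_one, hd] at h
  set ρ := rho k
  set N := ⋃ l ∈ Finset.Icc 2 ρ, S ∩ S ^ l
  have hN : IsNegligible m S N := isNegligible_biUnion_inter_pow hm hk hk' hS hsup
  have hfree : IsStronglyProductFree ρ (S \ N) := by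
    intro l hl hlρ
    rw [isProductFree_iff, Set.disjoint_left]
    rintro x ⟨hx, hxN⟩ hxl
    exact hxN (Set.mem_iUnion₂.2 ⟨l, Finset.mem_Icc.2 ⟨hl, hlρ⟩, hx,
      Set.pow_subset_pow_left Set.sdiff_subset hxl⟩)
  have hR := isUniformlyExtremal_diff hm hN hρ hfree hd
  obtain ⟨label, hlabel, hquot⟩ := hR.exists_label hm
  obtain ⟨s, hs⟩ := hR.nonempty hm
  refine ⟨label, fun r hr => ?_⟩
  by_contra hne
  -- With `e ≠ 0` the label sum of `r` minus `1`, the word `r ^ i * s ^ (k - 1 - i)` has label sum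
  -- `i * e + (k - 1)`. This can be made `0` since every positive integer below `ρ` divides `k - 1`.
  obtain ⟨i, hi, hie⟩ := exists_natCast_mul_add_eq_zero hdvd (by omega)
    (sub_ne_zero.2 (show (r.toList.map label).sum ≠ 1 from hne))
  -- `ρ - 1` divides `k - 1`, hence `i ≤ ρ - 1 ≤ k - 1`.
  have hik : i ≤ k - 1 := by
    have := Nat.le_of_dvd (by omega) (hdvd (ρ - 1) (by omega) (by omega))
    omega
  have hs1 : (s.toList.map label).sum = 1 := hlabel hs
  have hzero : ((r ^ i * s ^ (k - 1 - i)).toList.map label).sum = 0 := by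
    rw [sum_map_toList_mul, sum_map_toList_pow, sum_map_toList_pow, hs1, Nat.cast_sub hik, ← hie]
    ring
  have hdiff := hquot _ hzero
  obtain ⟨x, hx, hx'⟩ : ∃ x ∈ S \ N, r ^ i * s ^ (k - 1 - i) * x ∈ S \ N := by
    by_contra! hcon
    have h1 : (S \ N) \ leftQuotient (S \ N) (r ^ i * s ^ (k - 1 - i)) = S \ N :=
      sdiff_eq_left.2 (Set.disjoint_left.2 hcon)
    rw [h1, ← leftQuotient_one (S \ N), hR.eq_inv] at hdiff
    have : 0 < ρ := by omega
    have : (0 : ℝ) < 1 / ρ := by positivity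
    linarith
  refine Set.disjoint_left.1 (isProductFree_iff.1 hS) hx'.1 ?_
  rw [show k = i + (k - 1 - i) + 1 by omega, pow_succ S, pow_add S]
  have := Set.mul_mem_mul (Set.mul_mem_mul (Set.pow_mem_pow hr : r ^ i ∈ S ^ i)
    (Set.pow_mem_pow hs.1 : s ^ (k - 1 - i) ∈ S ^ (k - 1 - i))) hx.1
  rwa [show i + (k - 1 - i) + 1 - 1 - i = k - 1 - i by omega]

end

end

theorem theorem1p7 {A : Type*} [Fintype A] (k : ℕ) (hk : 2 ≤ k)
    (hk' : k ∉ ({3, 5, 7, 13} : Set ℕ)) (S : Set (FreeMonoid A))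
    (hS : IsProductFree k S)
    (hd : upperBanachDensity S = 1 / (rho k : ℝ)) :
    IsStronglyProductFree (rho k) S ∧
      ∃ label : A → ZMod (rho k),
        S ⊆ labelSumOne label ∧ IsProductFree k (labelSumOne label) := by
  obtain ⟨hρ, hndvd, -⟩ := rho_spec hk
  have hne : Nonempty A := by
    rw [← not_isEmpty_iff]
    intro h
    rw [upperBanachDensity_of_isEmpty] at hd
    have : 0 < rho k := by omega
    have : (0 : ℝ) < 1 / rho k := by positivity
    linarith
  obtain ⟨m, hm, hmS⟩ := exists_isWordMean S
  obtain ⟨label, hlabel⟩ := exists_label_of_isWordMean hm hk hk' hS (hmS.trans hd)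
  have hcast {l : ℕ} (hl : 1 ≤ l) (h : ¬ rho k ∣ l - 1) : (l : ZMod (rho k)) ≠ 1 := by
    intro h1
    rw [← Nat.cast_one, ZMod.natCast_eq_natCast_iff] at h1
    exact h ((Nat.modEq_iff_dvd' hl).1 h1.symm)
  -- `S` inherits strong `ρ`-product-freeness from `labelSumOne label`, because `0 < l - 1 < ρ`
  -- rules out `l ≡ 1` modulo `ρ`.
  refine ⟨fun l hl hlρ => (isProductFree_labelSumOne label (hcast (by omega) fun h => ?_)).mono
    hlabel, label, hlabel, isProductFree_labelSumOne label (hcast (by omega) hndvd)⟩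
  have := Nat.le_of_dvd (by omega) h
  omega
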